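/- Let $T\ge 2$, $n_t\ge T$, $n_r\ge 1$ be integers, let $\mathsf{snr}>0$, and put $\gamma=\mathsf{snr}/(1+\mathsf{snr})$. All logarithms are to base $2$. Consider the non-coherent one-bit block fading channel: over one coherence block of $T$ channel uses, an input $X\in\mathcal X_{\mathsf{snr}}=\{X=[x_1\cdots x_T]\in\mathbb R^{n_t\times T}:\ \|x_t\|\le\sqrt{\mathsf{snr}}\ \text{for all }t\}$ produces the output $Y=\operatorname{sign}(HX+Z)\in\{-1,1\}^{n_r\times T}$ (entrywise sign), where $H\in\mathbb R^{n_r\times n_t}$ and $Z\in\mathbb R^{n_r\times T}$ have i.i.d. $\mathcal N(0,1)$ entries, are independent of each other and of $X$, are drawn afresh in each block, and are known neither to the transmitter nor to the receiver. Let $C$ be the capacity in bits per channel use, that is, the supremum of the rates $R\ge0$ such that for every $\varepsilon>0$ and all large $n$ there is a code over $n$ blocks with at least $2^{nTR}$ messages, codewords in $\mathcal X_{\mathsf{snr}}^n$ and decoding error probability at most $\varepsilon$ for each message. Let $C_I=\frac1T\sup I(X;Y)$, the supremum being over all laws of $X$ on $\mathcal X_{\mathsf{snr}}$, be its single-letter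 expression. Let $\mathcal I$ be the set of the $\binom T2$ unordered pairs of distinct elements of $[T]$. For $q\in\mathbb R^{\mathcal I}$ let $\Sigma(q)$ be the symmetric $T\times T$ matrix with unit diagonal and off-diagonal entries $q_{\{j,k\}}$, let $\mathcal Q_\delta=\{q:\ \Sigma(q)\succeq(1-\delta)\mathrm I\}$ for $\delta\in[0,1)$ and $\mathcal Q_1=\bigcup_{\delta\in[0,1)}\mathcal Q_\delta$, and let $\mathrm{Vol}$ be Lebesgue measure on $\mathbb R^{\mathcal I}$. For an input $X$ and an output $Y$ let $$\rho_{\{j,k\}}(X)=\frac{x_j^{\mathsf T}x_k}{\sqrt{(1+\|x_j\|^2)(1+\|x_k\|^2)}},\qquad \hat q_{\{j,k\}}(Y)=\cos\Bigl(\frac{\pi}{n_r}\sum_{i=1}^{n_r}\mathbf 1\{Y_{ij}\ne Y_{ik}\}\Bigr).$$ Put $$R_{LB}=\frac{T-1}{4}\log\Bigl(\frac{\gamma^2}{2\pi^3e}\,n_r\Bigr)+\frac1T\log\mathrm{Vol}(\mathcal Q_1).$$ Then, non-asymptotically, $C\ge R_{LB}$ and $C_I\ge R_{LB}$. The bound is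 achieved by making $q=\rho(X)$ uniform on $\mathcal Q_\gamma$ and estimating $q$ by $\hat q(Y)$. Precisely, there is a law of $X$, supported on the matrices in $\mathcal X_{\mathsf{snr}}$ that are upper triangular with nonnegative diagonal and have all columns of norm exactly $\sqrt{\mathsf{snr}}$, for which $q=\rho(X)$ is uniformly distributed on $\mathcal Q_\gamma$; and for every law of $X$ on $\mathcal X_{\mathsf{snr}}$ for which $q=\rho(X)$ is uniformly distributed on $\mathcal Q_\gamma$, $$R_{LB}\le\frac1T\,I\bigl(q;\hat q(Y)\bigr)\qquad\text{and}\qquad I\bigl(q;\hat q(Y)\bigr)\le I(X;Y).$$ -/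

import Mathlib

open MeasureTheory ProbabilityTheory
open scoped ENNReal NNReal

noncomputable section

namespace OneBitMIMO

/-! ### Mutual information -/

/-- The mutual information, in bits, of a pair of random variables with joint law `P`: the
Kullback-Leibler divergence of `P` from the product of its marginals, divided by `ln 2`. -/
def mutualInfo {α β : Type*} [MeasurableSpace α] [MeasurableSpace β] (P : Measure (α × β)) :
    ℝ≥0∞ :=
  InformationTheory.klDiv P (P.fst.prod P.snd) / ENNReal.ofReal (Real.log 2)

/-! ### The channel `Y = sign (H X + Z)` -/

/-- The one-bit quantizer. The alphabet `{-1, 1}` is the group of units of `ℤ`. -/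
def sgn (x : ℝ) : ℤˣ := if 0 ≤ x then 1 else -1

/-- The set of channel outputs over one coherence block: sign matrices of size `nr × T`. -/
abbrev Output (nr T : ℕ) : Type := Fin nr → Fin T → ℤˣ

/-- Real `m × n` matrices, as functions of the row and the column, with the product
sigma-algebra. -/
abbrev Mat (m n : ℕ) : Type := Fin m → Fin n → ℝ

/-- The law of an `m × n` matrix with i.i.d. standard normal entries. -/
def gaussianMatrix (m n : ℕ) : Measure (Mat m n) :=
  Measure.pi fun _ : Fin m => Measure.pi fun _ : Fin n => gaussianReal 0 1

/-- The entrywise sign of `H X + Z`. -/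
def output {nt nr T : ℕ} (X : Mat nt T)
    (HZ : Mat nr nt × Mat nr T) : Output nr T :=
  fun k t => sgn ((∑ l, HZ.1 k l * X l t) + HZ.2 k t)

/-- The law of the output of one coherence block given the input matrix `X`; the fading matrix
`H` is known neither to the transmitter nor to the receiver. -/
def channel {nt T : ℕ} (nr : ℕ) (X : Mat nt T) : Measure (Output nr T) :=
  ((gaussianMatrix nr nt).prod (gaussianMatrix nr T)).map (output X)

/-- The joint law of `(X, Y)` when the input `X` has law `P` and is independent of `(H, Z)`. -/
def jointLaw {nt T : ℕ} (nr : ℕ) (P : Measure (Mat nt T)) :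
    Measure (Mat nt T × Output nr T) :=
  (P.prod ((gaussianMatrix nr nt).prod (gaussianMatrix nr T))).map
    fun w => (w.1, output w.1 w.2)

/-- The input matrices that meet the peak power constraint: every column has Euclidean norm at
most `√snr`. -/
def inputSet (nt T : ℕ) (snr : ℝ) : Set (Mat nt T) :=
  {X | ∀ t, ∑ l, X l t ^ 2 ≤ snr}

/-- The input matrices with columns of norm exactly `√snr` that are upper triangular with
nonnegative diagonal. -/
def triInputSet (nt T : ℕ) (snr : ℝ) : Set (Mat nt T) :=
  {X | (∀ t, ∑ l, X l t ^ 2 = snr) ∧ (∀ (l : Fin nt) (t : Fin T), (t : ℕ) < (l : ℕ) → X l t = 0) ∧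
    ∀ (l : Fin nt) (t : Fin T), (l : ℕ) = (t : ℕ) → 0 ≤ X l t}

/-! ### Capacity -/

/-- The rate `R`, in bits per channel use, is achievable over the memoryless block channel: for
every `ε > 0` and all large `n` there is a code of at least `2 ^ (n T R)` messages, whose codewords
consist of `n` admissible input matrices and which is decoded, from the `n` output blocks alone,
with error probability at most `ε` for every message. -/
def Achievable (nt nr T : ℕ) (snr R : ℝ) : Prop :=
  ∀ ε : ℝ, 0 < ε → ∀ᶠ n : ℕ in Filter.atTop,
    ∃ (M : ℕ) (enc : Fin M → Fin n → Mat nt T)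
      (dec : (Fin n → Output nr T) → Fin M),
      (2 : ℝ) ^ ((n : ℝ) * T * R) ≤ M ∧
      (∀ m i, enc m i ∈ inputSet nt T snr) ∧
      ∀ m, (Measure.pi fun i => channel nr (enc m i)).real {y | dec y ≠ m} ≤ ε

/-- The (operational) capacity of the non-coherent channel, in bits per channel use: the supremum
of the achievable rates. -/
def capacity (nt nr T : ℕ) (snr : ℝ) : ℝ≥0∞ :=
  ⨆ (R : ℝ≥0) (_ : Achievable nt nr T snr R), (R : ℝ≥0∞)

/-- The single-letter expression `(1 / T) sup I(X; Y)` of the capacity, in bits per channel use: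
the supremum is over all laws of the input matrix on the admissible set. -/
def infoCapacity (nt nr T : ℕ) (snr : ℝ) : ℝ≥0∞ :=
  (⨆ (P : Measure (Mat nt T)) (_ : IsProbabilityMeasure P)
    (_ : ∀ᵐ X ∂P, X ∈ inputSet nt T snr), mutualInfo (jointLaw nr P)) / T

/-! ### Correlation vectors -/

/-- The unordered pairs of distinct elements of `[T]`, each written in increasing order. -/
abbrev Pair (T : ℕ) : Type := {p : Fin T × Fin T // p.1 < p.2}

/-- The symmetric matrix with unit diagonal and off-diagonal entries `q`. -/
def corrMatrix {T : ℕ} (q : Pair T → ℝ) : Matrix (Fin T) (Fin T) ℝ :=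
  Matrix.of fun j k =>
    if h : j < k then q ⟨(j, k), h⟩ else if h : k < j then q ⟨(k, j), h⟩ else 1

/-- The region `𝒬_γ = {q | Σ(q) ⪰ (1 - γ) I}`. -/
def corrRegion (T : ℕ) (γ : ℝ) : Set (Pair T → ℝ) :=
  {q | (corrMatrix q - (1 - γ) • (1 : Matrix (Fin T) (Fin T) ℝ)).PosSemidef}

/-- The region `𝒬_1`, the union of the `𝒬_γ` over `0 ≤ γ < 1`. -/
def corrRegionOne (T : ℕ) : Set (Pair T → ℝ) :=
  ⋃ γ ∈ Set.Ico (0 : ℝ) 1, corrRegion T γ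

/-- The vector of correlation coefficients of the unquantized outputs given the input `X`. -/
def corr {nt T : ℕ} (X : Mat nt T) : Pair T → ℝ := fun p =>
  (∑ l, X l p.1.1 * X l p.1.2) /
    √((1 + ∑ l, X l p.1.1 ^ 2) * (1 + ∑ l, X l p.1.2 ^ 2))

/-- The estimate of the correlation vector: the cosine of `π` times the empirical frequency, over
the `nr` antennas, of the sign disagreements between two columns of the output. -/
def corrEstimate {nr T : ℕ} (Y : Output nr T) : Pair T → ℝ := fun p =>
  Real.cos (Real.pi / nr * ∑ k, if Y k p.1.1 ≠ Y k p.1.2 then 1 else 0)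

/-- The value `γ = snr / (1 + snr)`. -/
def gam (snr : ℝ) : ℝ := snr / (1 + snr)

/-- The lower bound on the rate, in bits per channel use. -/
def rateBound (nr T : ℕ) (snr : ℝ) : ℝ :=
  ((T : ℝ) - 1) / 4 *
      Real.logb 2 (gam snr ^ 2 / (2 * Real.pi ^ 3 * Real.exp 1) * nr) +
    1 / (T : ℝ) * Real.logb 2 (volume.real (corrRegionOne T))

end OneBitMIMO

end

open OneBitMIMO

/-!
The bound rests on one comparison of the true joint law of `(q, q̂)` with a Gaussian model. Let
`Q = 𝒬_γ`, let `m` be the number of pairs of columns, and let `s = π² / nr`. The score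
`vol(Q) · ∏ₚ φₛ(qₚ - q̂ₚ)`, with `φₛ` the centred normal density of variance `s`, integrates to at
most one in `q` under the uniform law on `Q`, whatever the value of `q̂`
(`integral_score_cond_le_one`). Its mean logarithm under the joint law is
`log vol(Q) - (m / 2) log (2 π s) - ∑ₚ E (qₚ - q̂ₚ)² / (2 s)`. Since `γ • 𝒬_1 ⊆ 𝒬_γ`, this is at
least the claimed rate, in nats per block, as soon as the mean square errors are at most `s`
(`mul_rateBound_le_integral_log_channelScore`).

The mean square error is controlled antenna by antenna (`integral_sq_corr_sub_corrEstimate_le`): two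
signs of a Gaussian pair with correlation `ρ` differ with probability `arccos ρ / π`
(`rowLaw_sgn_ne`), so the argument of the cosine in `q̂ₚ` is an unbiased empirical mean of `nr`
independent terms for `arccos qₚ`, and the cosine is a contraction. The orthant probability is found
by matching characteristic functions with an explicit planar pair and passing to polar coordinates.

A function with these two properties yields both kinds of lower bound without any entropy calculus.

* The Kullback-Leibler divergence of `μ` from `ν` is at least `∫ log f dμ` for every positive `f`
  with `∫ f dν ≤ 1` (`ofReal_integral_log_le_klDiv`). Applied to the score this bounds `I(q; q̂)`
  from below; data processing passes the bound on to `I(X; Y)` and to its supremum.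
* Threshold decoding of the product score over `n` blocks achieves every smaller rate with maximal
  error (`eventually_exists_block_code`). Codewords are chosen greedily as in Feinstein's argument;
  the weak law of large numbers makes the sent codeword pass the threshold, and Markov's inequality
  together with `∫ f(x, y) dP(x) ≤ 1` keeps the other ones below it.

The input law comes from the Cholesky decomposition. On triangular matrices with positive diagonal
and columns of norm `√snr`, the correlation map is injective and measurable, hence a measurable
embedding, and its image contains every `q` with `Σ(q) ≻ (1 - γ) I`. These `q` fill the convex set
`𝒬_γ` up to its boundary, which is a null set, so that the uniform law can be pulled back
(`exists_triangular_law`).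
-/

namespace OneBitMIMO

/-! ### The orthant formula for a Gaussian pair -/

instance : MeasurableSingletonClass ℤˣ where
  measurableSet_singleton u :=
    ⟨{(u : ℤ)}, MeasurableSet.of_discrete, by ext v; simp [Units.ext_iff]⟩

lemma charFunDual_gaussianReal (L : StrongDual ℝ ℝ) :
    charFunDual (gaussianReal 0 1) L = Complex.exp (-((L 1 ^ 2 : ℝ) : ℂ) / 2) := by
  have h2 : ∀ v : ℝ, L v = L 1 * v := fun v => by
    have := L.map_smul v 1
    rw [smul_eq_mul, mul_one, smul_eq_mul] at this
    rw [this, mul_comm]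
  generalize L 1 = c at h2 ⊢
  have h := charFun_gaussianReal (μ := 0) (v := 1) c
  rw [charFun_apply_real] at h
  simp_rw [charFunDual_apply, h2]
  push_cast at h ⊢
  rw [h]
  congr 1
  simp
  ring

lemma charFunDual_pi_gaussianReal {ι : Type*} [Fintype ι] [DecidableEq ι]
    (L : StrongDual ℝ (ι → ℝ)) :
    charFunDual (Measure.pi fun _ : ι => gaussianReal 0 1) L =
      Complex.exp (-((∑ i, L (Pi.single i 1) ^ 2 : ℝ) : ℂ) / 2) := by
  rw [charFunDual_pi]
  simp_rw [charFunDual_gaussianReal, ← Complex.exp_sum]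
  congr 1
  push_cast
  rw [← Finset.sum_div, ← Finset.sum_neg_distrib]
  rfl

/-- Two linear images of standard Gaussian vectors in the plane have the same law when their
covariances agree. The reference pair on the right consists of multiples of the components of a
planar standard normal vector along two unit vectors at angle `θ`; in polar coordinates these are
`r sin φ` and `r sin (φ - θ)`. -/
lemma map_gaussian_pair {m n : ℕ} (x y : Fin m → ℝ) {j k : Fin n} (hjk : j ≠ k) (a b θ : ℝ)
    (ha : a ^ 2 = 1 + ∑ l, x l ^ 2) (hb : b ^ 2 = 1 + ∑ l, y l ^ 2)
    (hab : a * b * Real.cos θ = ∑ l, x l * y l) :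
    ((Measure.pi fun _ : Fin m => gaussianReal 0 1).prod
        (Measure.pi fun _ : Fin n => gaussianReal 0 1)).map
      (fun w => ((∑ l, w.1 l * x l) + w.2 j, (∑ l, w.1 l * y l) + w.2 k)) =
    ((gaussianReal 0 1).prod (gaussianReal 0 1)).map
      (fun p : ℝ × ℝ => (a * p.2, b * (Real.cos θ * p.2 - Real.sin θ * p.1))) := by
  let π₁ (i : Fin m) : ((Fin m → ℝ) × (Fin n → ℝ)) →L[ℝ] ℝ :=
    (ContinuousLinearMap.proj (R := ℝ) (φ := fun _ : Fin m => ℝ) i).comp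
      (ContinuousLinearMap.fst ℝ (Fin m → ℝ) (Fin n → ℝ))
  let π₂ (i : Fin n) : ((Fin m → ℝ) × (Fin n → ℝ)) →L[ℝ] ℝ :=
    (ContinuousLinearMap.proj (R := ℝ) (φ := fun _ : Fin n => ℝ) i).comp
      (ContinuousLinearMap.snd ℝ (Fin m → ℝ) (Fin n → ℝ))
  let A : ((Fin m → ℝ) × (Fin n → ℝ)) →L[ℝ] ℝ × ℝ :=
    ((∑ l, x l • π₁ l) + π₂ j).prod ((∑ l, y l • π₁ l) + π₂ k)
  let f₁ := ContinuousLinearMap.fst ℝ ℝ ℝ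
  let f₂ := ContinuousLinearMap.snd ℝ ℝ ℝ
  let B : (ℝ × ℝ) →L[ℝ] ℝ × ℝ :=
    (a • f₂).prod (b • (Real.cos θ • f₂ - Real.sin θ • f₁))
  have hA : (fun w : (Fin m → ℝ) × (Fin n → ℝ) =>
      ((∑ l, w.1 l * x l) + w.2 j, (∑ l, w.1 l * y l) + w.2 k)) = A := by
    ext w <;> simp [A, π₁, π₂, mul_comm]
  have hB : (fun p : ℝ × ℝ => (a * p.2, b * (Real.cos θ * p.2 - Real.sin θ * p.1))) = B := by
    ext w <;> simp [B, f₁, f₂]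
  rw [hA, hB]
  refine Measure.ext_of_charFunDual ?_
  ext M
  rw [charFunDual_map, charFunDual_map, charFunDual_prod, charFunDual_prod,
    charFunDual_pi_gaussianReal, charFunDual_pi_gaussianReal, charFunDual_gaussianReal,
    charFunDual_gaussianReal, ← Complex.exp_add, ← Complex.exp_add]
  have hM : ∀ u v : ℝ, M (u, v) = u * M (1, 0) + v * M (0, 1) := fun u v => by
    rw [show ((u, v) : ℝ × ℝ) = u • ((1, 0) : ℝ × ℝ) + v • ((0, 1) : ℝ × ℝ) by simp, map_add,
      map_smul, map_smul]
    simp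
  set s := M (1, 0)
  set t := M (0, 1)
  have e1 : ∀ l, ((M.comp A).comp (.inl ℝ (Fin m → ℝ) (Fin n → ℝ))) (Pi.single l 1) =
      x l * s + y l * t := fun l => by
    simp [A, π₁, π₂, hM, Pi.single_apply]
  have e2 : ∀ i, ((M.comp A).comp (.inr ℝ (Fin m → ℝ) (Fin n → ℝ))) (Pi.single i 1) =
      (if j = i then 1 else 0) * s + (if k = i then 1 else 0) * t := fun i => by
    simp [A, π₁, π₂, hM, Pi.single_apply]
  have e3 : ((M.comp B).comp (.inl ℝ ℝ ℝ)) 1 = -(b * Real.sin θ) * t := by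
    simp [B, f₁, f₂, hM]
  have e4 : ((M.comp B).comp (.inr ℝ ℝ ℝ)) 1 = a * s + b * Real.cos θ * t := by
    simp [B, f₁, f₂, hM]
  simp_rw [e1, e2, e3, e4]
  rw [← add_div, ← add_div, ← neg_add, ← neg_add, ← Complex.ofReal_add, ← Complex.ofReal_add]
  have h1 : ∑ l, (x l * s + y l * t) ^ 2 =
      s ^ 2 * (∑ l, x l ^ 2) + 2 * s * t * (∑ l, x l * y l) + t ^ 2 * ∑ l, y l ^ 2 := by
    simp_rw [Finset.mul_sum, ← Finset.sum_add_distrib]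
    exact Finset.sum_congr rfl fun l _ => by ring
  have h2 : ∑ i, ((if j = i then (1 : ℝ) else 0) * s + (if k = i then 1 else 0) * t) ^ 2 =
      s ^ 2 + t ^ 2 := by
    have : ∀ i, ((if j = i then (1 : ℝ) else 0) * s + (if k = i then 1 else 0) * t) ^ 2 =
        (if j = i then s ^ 2 else 0) + (if k = i then t ^ 2 else 0) := fun i => by
      by_cases h : j = i <;> by_cases h' : k = i
      · exact absurd (h.trans h'.symm) hjk
      all_goals simp [h, h']
    simp_rw [this, Finset.sum_add_distrib]
    simp
  congr 4
  rw [h1, h2, ← hab]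
  linear_combination (-s ^ 2) * ha - t ^ 2 * hb + t ^ 2 * b ^ 2 * (-(Real.sin_sq_add_cos_sq θ))

/-- In polar coordinates the standard normal law of the plane has a uniform angle: the probability
of a cone is the length of its arc over `2 π`. -/
lemma gaussian_cone (S : Set (ℝ × ℝ)) (hS : MeasurableSet S) (D : Set ℝ) (hD : MeasurableSet D)
    (hcone : ∀ r φ : ℝ, 0 < r → φ ∈ Set.Ioo (-Real.pi) Real.pi →
      ((r * Real.cos φ, r * Real.sin φ) ∈ S ↔ φ ∈ D)) :
    ((gaussianReal 0 1).prod (gaussianReal 0 1)) S =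
      volume (D ∩ Set.Ioo (-Real.pi) Real.pi) / ENNReal.ofReal (2 * Real.pi) := by
  -- the radial factor is not computed: the total mass pins it down
  have key : ∃ c : ℝ≥0∞, ∀ (S : Set (ℝ × ℝ)) (_ : MeasurableSet S) (D : Set ℝ)
      (_ : MeasurableSet D)
      (_ : ∀ r φ : ℝ, 0 < r → φ ∈ Set.Ioo (-Real.pi) Real.pi →
      ((r * Real.cos φ, r * Real.sin φ) ∈ S ↔ φ ∈ D)),
      ((gaussianReal 0 1).prod (gaussianReal 0 1)) S =
        c * volume (D ∩ Set.Ioo (-Real.pi) Real.pi) := by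
    let g : ℝ → ℝ≥0∞ := fun r => ENNReal.ofReal r *
      (ENNReal.ofReal ((√(2 * Real.pi))⁻¹ * (√(2 * Real.pi))⁻¹ * Real.exp (- r ^ 2 / 2)))
    have hg : Measurable g := by fun_prop
    refine ⟨∫⁻ r in Set.Ioi 0, g r, fun S hS D hD h => ?_⟩
    have hdens : (gaussianReal 0 1).prod (gaussianReal 0 1) =
        (volume : Measure (ℝ × ℝ)).withDensity
          (fun p => gaussianPDF 0 1 p.1 * gaussianPDF 0 1 p.2) := by
      rw [gaussianReal_of_var_ne_zero _ one_ne_zero,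
        prod_withDensity (measurable_gaussianPDF _ _) (measurable_gaussianPDF _ _)]
      rfl
    rw [hdens, withDensity_apply _ hS, ← lintegral_indicator hS, ← lintegral_comp_polarCoord_symm]
    have htgt : polarCoord.target = Set.Ioi (0 : ℝ) ×ˢ Set.Ioo (-Real.pi) Real.pi := rfl
    have hrw : ∫⁻ p in polarCoord.target, ENNReal.ofReal p.1 •
          S.indicator (fun p => gaussianPDF 0 1 p.1 * gaussianPDF 0 1 p.2) (polarCoord.symm p) =
        ∫⁻ p in polarCoord.target, g p.1 * D.indicator 1 p.2 := by
      refine setLIntegral_congr_fun polarCoord.open_target.measurableSet fun p hp => ?_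
      obtain ⟨hp1, hp2⟩ := hp
      have hiff := h p.1 p.2 hp1 hp2
      simp only [polarCoord_symm_apply, smul_eq_mul]
      by_cases hpD : p.2 ∈ D
      · rw [Set.indicator_of_mem (hiff.2 hpD), Set.indicator_of_mem hpD]
        simp only [g, gaussianPDF, gaussianPDFReal, Pi.one_apply, mul_one]
        rw [← ENNReal.ofReal_mul (by positivity)]
        congr 2
        simp only [NNReal.coe_one, mul_one, sub_zero]
        rw [mul_mul_mul_comm, ← Real.exp_add]
        congr 2
        have := Real.sin_sq_add_cos_sq p.2
        field_simp
        linear_combination (-p.1 ^ 2) * this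
      · rw [Set.indicator_of_notMem (fun hc => hpD (hiff.1 hc)), Set.indicator_of_notMem hpD,
          mul_zero, mul_zero]
    rw [hrw, htgt, Measure.volume_eq_prod, ← Measure.prod_restrict,
      lintegral_prod_mul hg.aemeasurable (measurable_one.indicator hD).aemeasurable,
      lintegral_indicator_one hD, Measure.restrict_apply hD]
  obtain ⟨c, hc⟩ := key
  have h1 := hc Set.univ MeasurableSet.univ Set.univ MeasurableSet.univ (by simp)
  rw [measure_univ, Set.univ_inter, Real.volume_Ioo] at h1
  rw [hc S hS D hD hcone, ENNReal.div_eq_inv_mul]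
  congr 1
  rw [show Real.pi - -Real.pi = 2 * Real.pi by ring] at h1
  exact ENNReal.eq_inv_of_mul_eq_one_left h1.symm

lemma sgn_mul_of_pos {c : ℝ} (hc : 0 < c) (x : ℝ) : sgn (c * x) = sgn x := by
  simp [sgn, mul_nonneg_iff_of_pos_left hc]

lemma measurable_sgn : Measurable sgn :=
  Measurable.ite measurableSet_Ici measurable_const measurable_const

lemma sgn_ne_iff (x y : ℝ) : sgn x ≠ sgn y ↔ (0 ≤ x ∧ y < 0) ∨ (x < 0 ∧ 0 ≤ y) := by
  unfold sgn
  have : (-1 : ℤˣ) ≠ 1 := by decide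
  split_ifs with h1 h2 h2 <;> simp_all [not_le, not_lt]

/-- On the circle, the half-planes `sin φ ≥ 0` and `sin (φ - θ) ≥ 0` differ on two opposite arcs of
length `θ`. -/
lemma sgn_sin_ne_iff {θ φ : ℝ} (h0 : 0 < θ) (hπ : θ < Real.pi)
    (hφ : φ ∈ Set.Ioo (-Real.pi) Real.pi) :
    sgn (Real.sin φ) ≠ sgn (Real.sin (φ - θ)) ↔
      φ ∈ Set.Ico 0 θ ∪ Set.Ioc (-Real.pi) (θ - Real.pi) := by
  obtain ⟨h1, h2⟩ := hφ
  rw [sgn_ne_iff, Set.mem_union, Set.mem_Ico, Set.mem_Ioc]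
  have hπ0 := Real.pi_pos
  rcases le_or_gt 0 φ with h | h
  · have a1 : 0 ≤ Real.sin φ := Real.sin_nonneg_of_nonneg_of_le_pi h h2.le
    have : Real.sin (φ - θ) < 0 ↔ φ < θ := by
      rcases lt_or_ge φ θ with h' | h'
      · exact iff_of_true (Real.sin_neg_of_neg_of_neg_pi_lt (by linarith) (by linarith)) h'
      · exact iff_of_false
          (not_lt.2 (Real.sin_nonneg_of_nonneg_of_le_pi (by linarith) (by linarith))) (not_lt.2 h')
    rw [this]
    constructor
    · rintro (h3 | h3)
      · exact Or.inl ⟨h, h3.2⟩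
      · linarith [h3.1]
    · rintro (h3 | h3)
      · exact Or.inl ⟨a1, h3.2⟩
      · linarith [h3.2]
  · have a1 : Real.sin φ < 0 := Real.sin_neg_of_neg_of_neg_pi_lt h h1
    have : 0 ≤ Real.sin (φ - θ) ↔ φ ≤ θ - Real.pi := by
      rw [← Real.sin_add_two_pi]
      rcases le_or_gt φ (θ - Real.pi) with h' | h'
      · exact iff_of_true
          (Real.sin_nonneg_of_nonneg_of_le_pi (by linarith) (by linarith)) h'
      · rw [Real.sin_add_two_pi]
        exact iff_of_false
          (not_le.2 (Real.sin_neg_of_neg_of_neg_pi_lt (by linarith) (by linarith))) (not_le.2 h')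
    rw [this]
    constructor
    · rintro (h3 | h3)
      · linarith [h3.1]
      · exact Or.inr ⟨h1, h3.2⟩
    · rintro (h3 | h3)
      · linarith [h3.1]
      · exact Or.inr ⟨a1, h3.2⟩

/-- The orthant formula: the signs of two jointly Gaussian variables at angle `θ` differ with
probability `θ / π`. -/
lemma gaussian_sgn_ne {a b θ : ℝ} (ha : 0 < a) (hb : 0 < b) (h0 : 0 < θ) (hπ : θ < Real.pi) :
    (((gaussianReal 0 1).prod (gaussianReal 0 1)).map
      (fun p : ℝ × ℝ => (a * p.2, b * (Real.cos θ * p.2 - Real.sin θ * p.1)))).real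
        {q | sgn q.1 ≠ sgn q.2} = θ / Real.pi := by
  have hmeas : MeasurableSet {q : ℝ × ℝ | sgn q.1 ≠ sgn q.2} :=
    ((measurable_sgn.comp measurable_fst).prodMk (measurable_sgn.comp measurable_snd))
      (Set.toFinite {u : ℤˣ × ℤˣ | u.1 ≠ u.2}).measurableSet
  have hf : Measurable (fun p : ℝ × ℝ => (a * p.2, b * (Real.cos θ * p.2 - Real.sin θ * p.1))) := by
    fun_prop
  have hD : MeasurableSet (Set.Ico 0 θ ∪ Set.Ioc (-Real.pi) (θ - Real.pi)) :=
    measurableSet_Ico.union measurableSet_Ioc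
  have hπ0 := Real.pi_pos
  rw [measureReal_def, Measure.map_apply hf hmeas, gaussian_cone _ (hf hmeas) _ hD]
  · have hsub : (Set.Ico 0 θ ∪ Set.Ioc (-Real.pi) (θ - Real.pi)) ∩ Set.Ioo (-Real.pi) Real.pi =
        Set.Ico 0 θ ∪ Set.Ioc (-Real.pi) (θ - Real.pi) := by
      rw [Set.inter_eq_left]
      rintro x (hx | hx)
      · exact ⟨by linarith [hx.1], by linarith [hx.2]⟩
      · exact ⟨by linarith [hx.1], by linarith [hx.2]⟩
    rw [hsub, measure_union _ measurableSet_Ioc, Real.volume_Ico, Real.volume_Ioc,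
      ← ENNReal.ofReal_add (by linarith) (by linarith), ← ENNReal.ofReal_div_of_pos (by positivity),
      ENNReal.toReal_ofReal (by apply div_nonneg <;> linarith)]
    · field_simp
      ring
    · rw [Set.disjoint_left]
      intro x hx hx'
      linarith [hx.1, hx'.2]
  · intro r φ hr hφ
    simp only [Set.mem_preimage, Set.mem_ofPred_eq]
    rw [show b * (Real.cos θ * (r * Real.sin φ) - Real.sin θ * (r * Real.cos φ)) =
      (b * r) * Real.sin (φ - θ) by rw [Real.sin_sub]; ring, ← mul_assoc,
      sgn_mul_of_pos (by positivity), sgn_mul_of_pos (by positivity)]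
    exact sgn_sin_ne_iff h0 hπ hφ

/-! ### Mean square error of the correlation estimate -/

/-- The law of one row of `(H, Z)`. -/
noncomputable def rowLaw (nt T : ℕ) : Measure ((Fin nt → ℝ) × (Fin T → ℝ)) :=
  (Measure.pi fun _ => gaussianReal 0 1).prod (Measure.pi fun _ => gaussianReal 0 1)

instance (nt T : ℕ) : IsProbabilityMeasure (rowLaw nt T) := by
  unfold rowLaw; infer_instance

instance (m n : ℕ) : IsProbabilityMeasure (gaussianMatrix m n) := by
  unfold gaussianMatrix; infer_instance

/-- The sign at column `t` of the output row produced by the row `w` of `(H, Z)`. -/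
noncomputable def rowSgn {nt T : ℕ} (X : Mat nt T) (w : (Fin nt → ℝ) × (Fin T → ℝ))
    (t : Fin T) : ℤˣ :=
  sgn ((∑ l, w.1 l * X l t) + w.2 t)

lemma measurable_rowSgn {nt T : ℕ} (X : Mat nt T) (t : Fin T) :
    Measurable fun w => rowSgn X w t := by
  refine measurable_sgn.comp ?_
  fun_prop

lemma measurableSet_rowSgn_ne {nt T : ℕ} (X : Mat nt T) (j k : Fin T) :
    MeasurableSet {w | rowSgn X w j ≠ rowSgn X w k} :=
  ((measurable_rowSgn X j).prodMk (measurable_rowSgn X k))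
    (Set.toFinite {u : ℤˣ × ℤˣ | u.1 ≠ u.2}).measurableSet

lemma abs_corr_lt_one {nt T : ℕ} (X : Mat nt T) (p : Pair T) : |corr X p| < 1 := by
  have h1 : 0 ≤ ∑ l, X l p.1.1 ^ 2 := Finset.sum_nonneg fun _ _ => sq_nonneg _
  have h2 : 0 ≤ ∑ l, X l p.1.2 ^ 2 := Finset.sum_nonneg fun _ _ => sq_nonneg _
  have hcs := Finset.sum_mul_sq_le_sq_mul_sq Finset.univ (fun l => X l p.1.1) (fun l => X l p.1.2)
  have hpos : 0 < (1 + ∑ l, X l p.1.1 ^ 2) * (1 + ∑ l, X l p.1.2 ^ 2) := by positivity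
  unfold corr
  rw [abs_div, abs_of_pos (Real.sqrt_pos.2 hpos), div_lt_one (Real.sqrt_pos.2 hpos)]
  exact Real.lt_sqrt_of_sq_lt (by rw [sq_abs]; nlinarith)

/-- Two columns of the output disagree at a given antenna with probability `arccos ρ / π`, where
`ρ` is the correlation coefficient of the unquantized entries. -/
lemma rowLaw_sgn_ne {nt T : ℕ} (X : Mat nt T) (p : Pair T) :
    (rowLaw nt T).real {w | rowSgn X w p.1.1 ≠ rowSgn X w p.1.2} =
      Real.arccos (corr X p) / Real.pi := by
  have h1 : 0 ≤ ∑ l, X l p.1.1 ^ 2 := Finset.sum_nonneg fun _ _ => sq_nonneg _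
  have h2 : 0 ≤ ∑ l, X l p.1.2 ^ 2 := Finset.sum_nonneg fun _ _ => sq_nonneg _
  obtain ⟨hl, hu⟩ := abs_lt.1 (abs_corr_lt_one X p)
  have ha : 0 < √(1 + ∑ l, X l p.1.1 ^ 2) := Real.sqrt_pos.2 (by positivity)
  have hb : 0 < √(1 + ∑ l, X l p.1.2 ^ 2) := Real.sqrt_pos.2 (by positivity)
  have h0 : 0 < Real.arccos (corr X p) := Real.arccos_pos.2 hu
  have hπ : Real.arccos (corr X p) < Real.pi :=
    (Real.arccos_le_pi _).lt_of_ne fun h => by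
      rw [Real.arccos_eq_pi] at h; linarith
  have hmeas : MeasurableSet {q : ℝ × ℝ | sgn q.1 ≠ sgn q.2} :=
    ((measurable_sgn.comp measurable_fst).prodMk (measurable_sgn.comp measurable_snd))
      (Set.toFinite {u : ℤˣ × ℤˣ | u.1 ≠ u.2}).measurableSet
  rw [← gaussian_sgn_ne ha hb h0 hπ,
    ← map_gaussian_pair (m := nt) (n := T) (fun l => X l p.1.1) (fun l => X l p.1.2) p.2.ne _ _ _
      (Real.sq_sqrt (by positivity)) (Real.sq_sqrt (by positivity)),
    map_measureReal_apply (by fun_prop) hmeas]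
  · rfl
  · rw [Real.cos_arccos hl.le hu.le, ← Real.sqrt_mul (by positivity), corr,
      mul_div_cancel₀ _ (Real.sqrt_pos.2 (by positivity)).ne']

/-- The estimate of a correlation coefficient has mean square error at most `π² / nr`: its
argument is an empirical mean of `nr` independent indicators, times `π`, with expectation the
arc cosine of the coefficient, and the cosine is a contraction. -/
lemma integral_sq_corr_sub_corrEstimate_le {nt nr T : ℕ} (hnr : 1 ≤ nr) (X : Mat nt T)
    (p : Pair T) :
    ∫ w, (corr X p - corrEstimate (output X w) p) ^ 2
        ∂((gaussianMatrix nr nt).prod (gaussianMatrix nr T)) ≤ Real.pi ^ 2 / nr := by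
  have hnr0 : (0 : ℝ) < nr := by exact_mod_cast hnr
  obtain ⟨hl, hu⟩ := abs_lt.1 (abs_corr_lt_one X p)
  set θ := Real.arccos (corr X p) with hθ
  let D := {w | rowSgn X w p.1.1 ≠ rowSgn X w p.1.2}
  have hD : MeasurableSet D := measurableSet_rowSgn_ne X _ _
  let B : (Fin nt → ℝ) × (Fin T → ℝ) → ℝ := D.indicator 1
  have hB : Measurable B := measurable_one.indicator hD
  have hB01 : ∀ w, B w ∈ Set.Icc (0 : ℝ) 1 := fun w => by
    by_cases h : w ∈ D
    · simp [B, h]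
    · simp [B, h]
  have hBL : MemLp B 2 (rowLaw nt T) :=
    memLp_of_bounded (Filter.Eventually.of_forall hB01) hB.aestronglyMeasurable 2
  have hBint : ∫ w, B w ∂(rowLaw nt T) = θ / Real.pi := by
    rw [integral_indicator_one hD, rowLaw_sgn_ne]
  let ν := Measure.pi fun _ : Fin nr => rowLaw nt T
  let S : (Fin nr → (Fin nt → ℝ) × (Fin T → ℝ)) → ℝ := fun ω => Real.pi / nr * ∑ k, B (ω k)
  have hmp := measurePreserving_arrowProdEquivProdArrow (Fin nt → ℝ) (Fin T → ℝ) (Fin nr)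
    (fun _ => Measure.pi fun _ => gaussianReal 0 1) (fun _ => Measure.pi fun _ => gaussianReal 0 1)
  have hest : ∀ ω, corrEstimate (output X
      (MeasurableEquiv.arrowProdEquivProdArrow (Fin nt → ℝ) (Fin T → ℝ) (Fin nr) ω)) p =
      Real.cos (S ω) := fun ω => by
    unfold corrEstimate
    congr 2
    refine Finset.sum_congr rfl fun k _ => ?_
    simp only [B, D, Set.indicator_apply, Set.mem_ofPred_eq, Pi.one_apply]
    rfl
  have hBk : ∀ k, MemLp (fun ω : Fin nr → (Fin nt → ℝ) × (Fin T → ℝ) => B (ω k)) 2 ν := fun k =>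
    hBL.comp_measurePreserving (measurePreserving_eval (fun _ : Fin nr => rowLaw nt T) k)
  have hSL : MemLp S 2 ν := (memLp_finsetSum _ fun k _ => hBk k).const_mul _
  have hSmean : ∫ ω, S ω ∂ν = θ := by
    have : ∀ k : Fin nr, ∫ ω, B (ω k) ∂ν = θ / Real.pi := fun k => by
      rw [← hBint]
      exact integral_comp_eval (μ := fun _ : Fin nr => rowLaw nt T) hB.aestronglyMeasurable
    simp only [S]
    rw [integral_const_mul, integral_finsetSum _ fun k _ => (hBk k).integrable one_le_two]
    simp_rw [this]
    have := Real.pi_pos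
    simp
    field_simp
  have hvar : Var[S; ν] ≤ Real.pi ^ 2 / nr := by
    have h1 : Var[∑ k, fun ω : Fin nr → (Fin nt → ℝ) × (Fin T → ℝ) => B (ω k); ν] =
        ∑ _k : Fin nr, Var[B; rowLaw nt T] :=
      variance_sum_pi (X := fun _ => B) fun _ => hBL
    have h2 : Var[B; rowLaw nt T] ≤ 1 :=
      (variance_le_sq_of_bounded (Filter.Eventually.of_forall hB01) hB.aemeasurable).trans
        (by norm_num)
    have h3 : S = fun ω => Real.pi / nr *
        (∑ k, fun ω : Fin nr → (Fin nt → ℝ) × (Fin T → ℝ) => B (ω k)) ω := by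
      ext ω; simp [S]
    rw [h3, variance_const_mul, h1]
    simp only [Finset.sum_const, Finset.card_univ, Fintype.card_fin, nsmul_eq_mul]
    calc (Real.pi / nr) ^ 2 * (nr * Var[B; rowLaw nt T])
        ≤ (Real.pi / nr) ^ 2 * (nr * 1) := by gcongr
      _ = Real.pi ^ 2 / nr := by field_simp
  calc _ = ∫ ω, (corr X p - Real.cos (S ω)) ^ 2 ∂ν := by
        simp_rw [← hest]
        exact (hmp.integral_comp' (fun w => (corr X p - corrEstimate (output X w) p) ^ 2)).symm
    _ ≤ ∫ ω, (S ω - ∫ ω, S ω ∂ν) ^ 2 ∂ν := by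
        refine integral_mono_of_nonneg (Filter.Eventually.of_forall fun _ => sq_nonneg _)
          (hSL.sub (memLp_const _)).integrable_sq (Filter.Eventually.of_forall fun ω => ?_)
        simp only
        rw [hSmean, ← Real.cos_arccos hl.le hu.le, ← hθ, ← sq_abs, ← sq_abs (S ω - θ),
          abs_sub_comm (S ω)]
        exact pow_le_pow_left₀ (abs_nonneg _) (Real.abs_cos_sub_cos_le _ _) 2
    _ = Var[S; ν] := (variance_eq_integral hSL.aemeasurable).symm
    _ ≤ _ := hvar

/-! ### A variational bound and a one-shot coding bound -/

/-- A variational lower bound on the Kullback-Leibler divergence: any positive function of `ν`-mass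
at most one may stand in for the density `dμ/dν`. -/
lemma ofReal_integral_log_le_klDiv {α : Type*} [MeasurableSpace α] {μ ν : Measure α}
    [IsProbabilityMeasure μ] [IsProbabilityMeasure ν] {f : α → ℝ} (hf : Measurable f)
    (hpos : ∀ x, 0 < f x) (hlog : Integrable (fun x => Real.log (f x)) μ) (hfi : Integrable f ν)
    (h1 : ∫ x, f x ∂ν ≤ 1) :
    ENNReal.ofReal (∫ x, Real.log (f x) ∂μ) ≤ InformationTheory.klDiv μ ν := by
  by_cases htop : InformationTheory.klDiv μ ν = ∞
  · rw [htop]; exact le_top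
  obtain ⟨hac, hllr⟩ := InformationTheory.klDiv_ne_top_iff.1 htop
  rw [InformationTheory.klDiv_of_ac_of_integrable hac hllr]
  refine ENNReal.ofReal_le_ofReal ?_
  simp only [probReal_univ, add_sub_cancel_right]
  -- pointwise `log f - log r ≤ f / r - 1`, and `f / r` has `μ`-mean at most `∫ f dν`; where the
  -- density `r` vanishes, the convention `f / 0 = 0` only decreases the integrand
  let r : α → ℝ := fun x => (μ.rnDeriv ν x).toReal
  have hr : Measurable r := (Measure.measurable_rnDeriv μ ν).ennreal_toReal
  have hr0 : ∀ x, 0 ≤ r x := fun x => ENNReal.toReal_nonneg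
  have hle : ∀ x, r x • (f x / r x) ≤ f x := fun x => by
    rcases (hr0 x).eq_or_lt with h | h
    · simp [← h, (hpos x).le]
    · rw [smul_eq_mul, mul_div_cancel₀ _ h.ne']
  have hle0 : ∀ x, 0 ≤ r x • (f x / r x) := fun x =>
    mul_nonneg (hr0 x) (div_nonneg (hpos x).le (hr0 x))
  have hint : Integrable (fun x => r x • (f x / r x)) ν :=
    hfi.mono' (hr.smul (hf.div hr)).aestronglyMeasurable
      (Filter.Eventually.of_forall fun x => by
        rw [Real.norm_of_nonneg (hle0 x)]; exact hle x)
  have hint' : Integrable (fun x => f x / r x) μ := (integrable_rnDeriv_smul_iff hac).1 hint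
  have hbound : ∫ x, f x / r x ∂μ ≤ 1 := by
    rw [← integral_rnDeriv_smul hac]
    exact (integral_mono hint hfi hle).trans h1
  have hpt : ∀ᵐ x ∂μ, Real.log (f x) - llr μ ν x ≤ f x / r x - 1 := by
    filter_upwards [Measure.rnDeriv_pos hac, hac.ae_le (Measure.rnDeriv_lt_top μ ν)] with x h h'
    have hrx : 0 < r x := ENNReal.toReal_pos h.ne' h'.ne
    rw [llr, ← Real.log_div (hpos x).ne' hrx.ne']
    exact Real.log_le_sub_one_of_pos (div_pos (hpos x) hrx)
  have := integral_mono_ae (hlog.sub hllr) (hint'.sub (integrable_const 1)) hpt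
  simp only [Pi.sub_apply] at this
  rw [integral_sub hlog hllr, integral_sub hint' (integrable_const 1)] at this
  simp at this
  linarith

lemma integrable_of_nonneg_of_le {α : Type*} [MeasurableSpace α] {μ : Measure α}
    [IsFiniteMeasure μ] {g : α → ℝ} (hg : Measurable g) (C : ℝ) (h0 : ∀ x, 0 ≤ g x)
    (hC : ∀ x, g x ≤ C) : Integrable g μ :=
  Integrable.of_bound hg.aestronglyMeasurable C
    (Filter.Eventually.of_forall fun x => by rw [Real.norm_of_nonneg (h0 x)]; exact hC x)

open Classical in
/-- A one-shot coding bound with maximal error, in the manner of Feinstein. The codewords are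
chosen one after the other and the decoder returns the first codeword whose score `f` exceeds the
threshold `A`. Each new codeword must (i) exceed its own threshold with high probability, (ii) be
unlikely to be exceeded under the unconditional output law, and (iii) produce outputs that are
unlikely to exceed the thresholds of the previous codewords. On average over the input law all
three hold with room to spare, so that a suitable codeword exists. -/
theorem exists_code_of_threshold {𝒳 𝒴 : Type*} [MeasurableSpace 𝒳] [Fintype 𝒴] (P : Measure 𝒳)
    [IsProbabilityMeasure P] (W f : 𝒳 → 𝒴 → ℝ) (hWm : ∀ y, Measurable fun x => W x y)
    (hW0 : ∀ x y, 0 ≤ W x y) (hW1 : ∀ x, ∑ y, W x y = 1) (hfm : ∀ y, Measurable fun x => f x y)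
    (hf0 : ∀ x y, 0 ≤ f x y) (hfi : ∀ y, Integrable (fun x => f x y) P)
    (hf1 : ∀ y, ∫ x, f x y ∂P ≤ 1) {S : Set 𝒳} (hS : ∀ᵐ x ∂P, x ∈ S) {A ε : ℝ} (hA : 0 < A)
    (hε : 0 < ε) {M : ℕ} (hM0 : 0 < M)
    (hp : ∫ x, ∑ y, (if f x y ≤ A then W x y else 0) ∂P ≤ ε / 8) (hM : M ≤ ε * A / 32) :
    ∃ (enc : Fin M → 𝒳) (dec : 𝒴 → Fin M), (∀ m, enc m ∈ S) ∧
      ∀ m, ∑ y, (if dec y ≠ m then W (enc m) y else 0) ≤ ε := by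
  have hW1' : ∀ x y, W x y ≤ 1 := fun x y => by
    rw [← hW1 x]
    exact Finset.single_le_sum (fun y _ => hW0 x y) (Finset.mem_univ y)
  have hWi : ∀ y, Integrable (fun x => W x y) P := fun y =>
    integrable_of_nonneg_of_le (hWm y) 1 (fun x => hW0 x y) fun x => hW1' x y
  let q : 𝒴 → ℝ := fun y => ∫ x, W x y ∂P
  have hq0 : ∀ y, 0 ≤ q y := fun y => integral_nonneg fun x => hW0 x y
  have hq1 : ∑ y, q y = 1 := by
    rw [← integral_finsetSum _ fun y _ => hWi y]
    simp [hW1]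
  let good : (ℕ → 𝒳) → ℕ → Prop := fun c i => c i ∈ S ∧
    ∑ y, (if f (c i) y ≤ A then W (c i) y else 0) ≤ ε / 2 ∧
    ∑ y, (if A < f (c i) y then q y else 0) ≤ 4 / A ∧
    ∑ y, (if ∃ j < i, A < f (c j) y then W (c i) y else 0) ≤ ε / 2
  have step : ∀ (c : ℕ → 𝒳) (m : ℕ), m < M → (∀ i < m, good c i) → ∃ x ∈ S,
      ∑ y, (if f x y ≤ A then W x y else 0) ≤ ε / 2 ∧
      ∑ y, (if A < f x y then q y else 0) ≤ 4 / A ∧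
      ∑ y, (if ∃ j < m, A < f (c j) y then W x y else 0) ≤ ε / 2 := by
    intro c m hm hc
    let a : 𝒳 → ℝ := fun x => ∑ y, (if f x y ≤ A then W x y else 0)
    let b : 𝒳 → ℝ := fun x => ∑ y, (if A < f x y then q y else 0)
    let d : 𝒳 → ℝ := fun x => ∑ y, (if ∃ j < m, A < f (c j) y then W x y else 0)
    have ha0 : ∀ x, 0 ≤ a x := fun x => Finset.sum_nonneg fun y _ => by
      split_ifs; exacts [hW0 x y, le_rfl]
    have hb0 : ∀ x, 0 ≤ b x := fun x => Finset.sum_nonneg fun y _ => by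
      split_ifs; exacts [hq0 y, le_rfl]
    have hd0 : ∀ x, 0 ≤ d x := fun x => Finset.sum_nonneg fun y _ => by
      split_ifs; exacts [hW0 x y, le_rfl]
    have hai : Integrable a P := integrable_of_nonneg_of_le
      (Finset.measurable_sum _ fun y _ =>
        Measurable.ite (measurableSet_le (hfm y) measurable_const) (hWm y) measurable_const)
      1 ha0 fun x => by
        rw [← hW1 x]
        exact Finset.sum_le_sum fun y _ => by split_ifs; exacts [le_rfl, hW0 x y]
    have hbi : Integrable b P := integrable_of_nonneg_of_le
      (Finset.measurable_sum _ fun y _ =>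
        Measurable.ite (measurableSet_lt measurable_const (hfm y)) measurable_const
          measurable_const)
      1 hb0 fun x => by
        rw [← hq1]
        exact Finset.sum_le_sum fun y _ => by split_ifs; exacts [le_rfl, hq0 y]
    have hdi' : ∀ y, Integrable
        (fun x => if ∃ j < m, A < f (c j) y then W x y else 0) P := fun y => by
      by_cases h : ∃ j < m, A < f (c j) y
      · simpa only [if_pos h] using hWi y
      · simp only [if_neg h]; exact integrable_zero _ _ _
    have hdi : Integrable d P := integrable_finsetSum _ fun y _ => hdi' y
    have hb : ∫ x, b x ∂P ≤ 1 / A := by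
      have h1 : ∀ x, b x ≤ ∑ y, q y / A * f x y := fun x => Finset.sum_le_sum fun y _ => by
        split_ifs with h
        · rw [div_mul_eq_mul_div, le_div_iff₀ hA]
          exact mul_le_mul_of_nonneg_left h.le (hq0 y)
        · exact mul_nonneg (div_nonneg (hq0 y) hA.le) (hf0 x y)
      calc ∫ x, b x ∂P ≤ ∫ x, ∑ y, q y / A * f x y ∂P :=
            integral_mono hbi (integrable_finsetSum _ fun y _ => (hfi y).const_mul _) h1
        _ = ∑ y, q y / A * ∫ x, f x y ∂P := by
            rw [integral_finsetSum _ fun y _ => (hfi y).const_mul _]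
            simp_rw [integral_const_mul]
        _ ≤ ∑ y, q y / A * 1 := Finset.sum_le_sum fun y _ =>
            mul_le_mul_of_nonneg_left (hf1 y) (div_nonneg (hq0 y) hA.le)
        _ = 1 / A := by simp_rw [mul_one]; rw [← Finset.sum_div, hq1]
    have hd : ∫ x, d x ∂P ≤ M * (4 / A) := by
      calc ∫ x, d x ∂P = ∑ y, (if ∃ j < m, A < f (c j) y then q y else 0) := by
            rw [integral_finsetSum _ fun y _ => hdi' y]
            refine Finset.sum_congr rfl fun y _ => ?_
            split_ifs <;> simp [q]
        _ ≤ ∑ y, ∑ j ∈ Finset.range m, (if A < f (c j) y then q y else 0) := by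
            refine Finset.sum_le_sum fun y _ => ?_
            have hnn : ∀ j ∈ Finset.range m, 0 ≤ (if A < f (c j) y then q y else 0) :=
              fun j _ => by split_ifs; exacts [hq0 y, le_rfl]
            split_ifs with h
            · obtain ⟨j, hj, hj'⟩ := h
              calc q y = (if A < f (c j) y then q y else 0) := (if_pos hj').symm
                _ ≤ _ := Finset.single_le_sum hnn (Finset.mem_range.2 hj)
            · exact Finset.sum_nonneg hnn
        _ = ∑ j ∈ Finset.range m, ∑ y, (if A < f (c j) y then q y else 0) := Finset.sum_comm
        _ ≤ ∑ j ∈ Finset.range m, 4 / A :=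
            Finset.sum_le_sum fun j hj => (hc j (Finset.mem_range.1 hj)).2.2.1
        _ = m * (4 / A) := by simp
        _ ≤ M * (4 / A) := by gcongr
    -- weighted so that `Φ x ≤ 1` implies all three requirements, while each term has mean at
    -- most `1 / 4`
    let Φ : 𝒳 → ℝ := fun x => 2 / ε * a x + A / 4 * b x + 2 / ε * d x
    have hΦi : Integrable Φ P :=
      ((hai.const_mul _).add (hbi.const_mul _)).add (hdi.const_mul _)
    have hΦ : ∫ x, Φ x ∂P ≤ 3 / 4 := by
      have e : ∫ x, Φ x ∂P = 2 / ε * ∫ x, a x ∂P + A / 4 * ∫ x, b x ∂P + 2 / ε * ∫ x, d x ∂P := by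
        have hab : Integrable (fun x => 2 / ε * a x + A / 4 * b x) P :=
          (hai.const_mul _).add (hbi.const_mul _)
        simp only [Φ]
        rw [integral_add hab (hdi.const_mul _),
          integral_add (hai.const_mul _) (hbi.const_mul _)]
        simp_rw [integral_const_mul]
      have e1 : 2 / ε * ∫ x, a x ∂P ≤ 2 / ε * (ε / 8) := by gcongr
      have e2 : A / 4 * ∫ x, b x ∂P ≤ A / 4 * (1 / A) := by gcongr
      have e3 : 2 / ε * ∫ x, d x ∂P ≤ 2 / ε * ((ε * A / 32) * (4 / A)) := by
        refine mul_le_mul_of_nonneg_left (hd.trans ?_) (by positivity)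
        gcongr
      have e1' : 2 / ε * (ε / 8) = 1 / 4 := by field_simp; norm_num
      have e2' : A / 4 * (1 / A) = 1 / 4 := by field_simp
      have e3' : 2 / ε * ((ε * A / 32) * (4 / A)) = 1 / 4 := by field_simp; norm_num
      linarith
    obtain ⟨x, hxS, hx⟩ := exists_notMem_null_le_integral hΦi (N := Sᶜ) (ae_iff.1 hS)
    have hx1 : Φ x ≤ 3 / 4 := hx.trans hΦ
    have t1 : 0 ≤ 2 / ε * a x := mul_nonneg (by positivity) (ha0 x)
    have t2 : 0 ≤ A / 4 * b x := mul_nonneg (by positivity) (hb0 x)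
    have t3 : 0 ≤ 2 / ε * d x := mul_nonneg (by positivity) (hd0 x)
    simp only [Φ] at hx1
    refine ⟨x, by simpa using hxS, ?_, ?_, ?_⟩
    · have : 2 / ε * a x ≤ 1 := by linarith
      rw [div_mul_eq_mul_div, div_le_one hε] at this
      simp only [a] at this
      linarith
    · have : A / 4 * b x ≤ 1 := by linarith
      rw [div_mul_eq_mul_div, div_le_one (by norm_num)] at this
      rw [le_div_iff₀ hA, mul_comm]
      exact this
    · have : 2 / ε * d x ≤ 1 := by linarith
      rw [div_mul_eq_mul_div, div_le_one hε] at this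
      simp only [d] at this
      linarith
  -- a sequence defined on all of `ℕ`, updated at `m`, keeps the earlier codewords in place
  have ex : ∀ m ≤ M, ∃ c : ℕ → 𝒳, ∀ i < m, good c i := by
    intro m
    induction m with
    | zero =>
      intro _
      have : Nonempty 𝒳 := P.nonempty_of_neZero
      exact ⟨fun _ => Classical.arbitrary 𝒳, fun i hi => absurd hi (Nat.not_lt_zero i)⟩
    | succ m ih =>
      intro hm
      obtain ⟨c, hc⟩ := ih (Nat.le_of_succ_le hm)
      obtain ⟨x, hxS, h1, h2, h3⟩ := step c m hm hc
      have hlt : ∀ j < m, Function.update c m x j = c j := fun j hj =>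
        Function.update_of_ne hj.ne _ _
      refine ⟨Function.update c m x, fun i hi => ?_⟩
      have hcongr : ∀ i ≤ m, ∀ y, (∃ j < i, A < f (Function.update c m x j) y) ↔
          ∃ j < i, A < f (c j) y := fun i hi y =>
        exists_congr fun j => and_congr_right fun hj => by rw [hlt j (hj.trans_le hi)]
      rcases Nat.lt_succ_iff_lt_or_eq.1 hi with h | h
      · have hci := hc i h
        simp only [good] at hci ⊢
        simp only [hcongr i h.le, hlt i h]
        exact hci
      · subst h
        simp only [good]
        simp only [hcongr i le_rfl, Function.update_self]
        exact ⟨hxS, h1, h2, h3⟩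
  obtain ⟨c, hc⟩ := ex M le_rfl
  refine ⟨fun m => c m, fun y => if h : ∃ i, i < M ∧ A < f (c i) y then
    ⟨Nat.find h, (Nat.find_spec h).1⟩ else ⟨0, hM0⟩, fun m => (hc m m.2).1, fun m => ?_⟩
  obtain ⟨-, h1, -, h3⟩ := hc m m.2
  calc _ ≤ ∑ y, ((if f (c m) y ≤ A then W (c m) y else 0) +
        (if ∃ j < (m : ℕ), A < f (c j) y then W (c m) y else 0)) := by
        refine Finset.sum_le_sum fun y _ => ?_
        by_cases hy : f (c m) y ≤ A
        · rw [if_pos hy]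
          have : 0 ≤ (if ∃ j < (m : ℕ), A < f (c j) y then W (c m) y else 0) := by
            split_ifs; exacts [hW0 _ _, le_rfl]
          split_ifs at this ⊢ <;> linarith [hW0 (c m) y]
        · by_cases hy' : ∃ j < (m : ℕ), A < f (c j) y
          · rw [if_neg hy, if_pos hy', zero_add]
            split_ifs; exacts [le_rfl, hW0 _ _]
          · have hex : ∃ i, i < M ∧ A < f (c i) y := ⟨m, m.2, not_le.1 hy⟩
            have hfind : Nat.find hex = m := (Nat.find_eq_iff hex).2
              ⟨⟨m.2, not_le.1 hy⟩, fun j hj hj' => hy' ⟨j, hj, hj'.2⟩⟩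
            rw [if_neg, if_neg hy, if_neg hy', zero_add]
            rw [not_not]
            beta_reduce
            rw [dif_pos hex]
            exact Fin.ext hfind
    _ ≤ ε / 2 + ε / 2 := by rw [Finset.sum_add_distrib]; exact add_le_add h1 h3
    _ = ε := add_halves ε

/-! ### Block codes for a memoryless channel -/

/-- The weak law of large numbers for a bounded function under a product measure, as a bound on
the lower tail of the sum. -/
lemma eventually_pi_sum_le {α : Type*} [MeasurableSpace α] (ρ : Measure α) [IsProbabilityMeasure ρ]
    {h : α → ℝ} (hm : Measurable h) {K : ℝ} (hK : ∀ x, |h x| ≤ K) {r : ℝ}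
    (hr : r < ∫ x, h x ∂ρ) {δ : ℝ} (hδ : 0 < δ) :
    ∀ᶠ n : ℕ in Filter.atTop,
      (Measure.pi fun _ : Fin n => ρ).real {v | ∑ i, h (v i) ≤ n * r} ≤ δ := by
  set a := ∫ x, h x ∂ρ
  have hlim : Filter.Tendsto (fun n : ℕ => K ^ 2 / (a - r) ^ 2 / (n : ℝ)) Filter.atTop (nhds 0) :=
    tendsto_const_div_atTop_nhds_zero_nat _
  filter_upwards [hlim.eventually_le_const hδ, Filter.eventually_gt_atTop 0] with n hn hn0
  refine le_trans ?_ hn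
  have hn0' : (0 : ℝ) < n := by exact_mod_cast hn0
  have har : 0 < a - r := sub_pos.2 hr
  have hIcc : ∀ x, h x ∈ Set.Icc (-K) K := fun x => abs_le.1 (hK x)
  have hL : MemLp h 2 ρ :=
    memLp_of_bounded (Filter.Eventually.of_forall hIcc) hm.aestronglyMeasurable 2
  let ν := Measure.pi fun _ : Fin n => ρ
  let S : (Fin n → α) → ℝ := ∑ i, fun v : Fin n → α => h (v i)
  have hSi : ∀ i, MemLp (fun v : Fin n → α => h (v i)) 2 ν := fun i =>
    hL.comp_measurePreserving (measurePreserving_eval (fun _ : Fin n => ρ) i)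
  have hSL : MemLp S 2 ν := memLp_finsetSum' _ fun i _ => hSi i
  have hSapp : ∀ v, S v = ∑ i, h (v i) := fun v => by simp [S]
  have hmean : ∫ v, S v ∂ν = n * a := by
    simp_rw [hSapp]
    rw [integral_finsetSum _ fun i _ => (hSi i).integrable one_le_two]
    have : ∀ i : Fin n, ∫ v, h (v i) ∂ν = a := fun i =>
      integral_comp_eval (μ := fun _ : Fin n => ρ) hm.aestronglyMeasurable
    simp [this]
  have hvar : Var[S; ν] ≤ n * K ^ 2 := by
    have h1 : Var[S; ν] = ∑ _i : Fin n, Var[h; ρ] := variance_sum_pi (X := fun _ => h) fun _ => hL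
    have h2 : Var[h; ρ] ≤ K ^ 2 :=
      (variance_le_sq_of_bounded (Filter.Eventually.of_forall hIcc) hm.aemeasurable).trans_eq
        (by ring)
    rw [h1]
    simpa using mul_le_mul_of_nonneg_left h2 hn0'.le
  have hc : 0 < n * (a - r) := by positivity
  have hcheb := meas_ge_le_variance_div_sq hSL hc
  have hsub : {v : Fin n → α | ∑ i, h (v i) ≤ n * r} ⊆ {v | n * (a - r) ≤ |S v - ∫ v, S v ∂ν|} := by
    intro v hv
    simp only [Set.mem_ofPred_eq] at hv ⊢
    rw [hmean, hSapp, abs_sub_comm]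
    exact le_trans (by linarith) (le_abs_self _)
  calc ν.real {v | ∑ i, h (v i) ≤ n * r}
      ≤ Var[S; ν] / (n * (a - r)) ^ 2 :=
        ENNReal.toReal_le_of_le_ofReal (div_nonneg (variance_nonneg _ _) (sq_nonneg _))
          ((measure_mono hsub).trans hcheb)
    _ ≤ (n * K ^ 2) / (n * (a - r)) ^ 2 := by gcongr
    _ = K ^ 2 / (a - r) ^ 2 / n := by field_simp

lemma sum_ite_measureReal_singleton {𝒴 : Type*} [Fintype 𝒴] [MeasurableSpace 𝒴]
    [MeasurableSingletonClass 𝒴] (μ : Measure 𝒴) [IsFiniteMeasure μ] (p : 𝒴 → Prop)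
    [DecidablePred p] :
    ∑ y, (if p y then μ.real {y} else 0) = μ.real {y | p y} := by
  rw [← Finset.sum_filter, sum_measureReal_singleton]
  simp

/-- Reliable block codes for a memoryless channel of the form `y = out x ω`, with
finite output alphabet and noise `ω` of law `G`. The score `f` need not be the true
information density: it suffices that it averages to at most one over the input law `P`, for each
output. Every rate below the mean of `log f` is then achieved, with maximal error probability and
codewords in a set of full `P`-measure. -/
theorem eventually_exists_block_code {𝒳 Ω 𝒴 : Type*} [MeasurableSpace 𝒳] [MeasurableSpace Ω]
    [Fintype 𝒴] [MeasurableSpace 𝒴] [MeasurableSingletonClass 𝒴] (P : Measure 𝒳)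
    [IsProbabilityMeasure P] (G : Measure Ω) [IsProbabilityMeasure G] (out : 𝒳 → Ω → 𝒴)
    (hout : Measurable (Function.uncurry out)) (f : 𝒳 → 𝒴 → ℝ)
    (hfm : ∀ y, Measurable fun x => f x y) (hf0 : ∀ x y, 0 < f x y) {K : ℝ}
    (hK : ∀ x y, |Real.log (f x y)| ≤ K) (hf1 : ∀ y, ∫ x, f x y ∂P ≤ 1) {S : Set 𝒳}
    (hS : ∀ᵐ x ∂P, x ∈ S) {r : ℝ} (hr0 : 0 ≤ r)
    (hr : r < ∫ w, Real.log (f w.1 (out w.1 w.2)) ∂(P.prod G)) {ε : ℝ} (hε : 0 < ε) :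
    ∀ᶠ n : ℕ in Filter.atTop, ∃ (M : ℕ) (enc : Fin M → Fin n → 𝒳) (dec : (Fin n → 𝒴) → Fin M),
      Real.exp (n * r) ≤ M ∧ (∀ m i, enc m i ∈ S) ∧
      ∀ m, (Measure.pi fun i => G.map (out (enc m i))).real {y | dec y ≠ m} ≤ ε := by
  classical
  have houtx : ∀ x, Measurable (out x) := fun x => hout.comp measurable_prodMk_left
  have hprob : ∀ x, IsProbabilityMeasure (G.map (out x)) := fun x =>
    Measure.isProbabilityMeasure_map (houtx x).aemeasurable
  have hfu : Measurable fun w : 𝒳 × 𝒴 => f w.1 w.2 := measurable_from_prod_countable_left hfm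
  let h : 𝒳 × Ω → ℝ := fun w => Real.log (f w.1 (out w.1 w.2))
  have hhm : Measurable h := (hfu.comp (measurable_fst.prodMk hout)).log
  have hfi : ∀ y, Integrable (fun x => f x y) P := fun y =>
    integrable_of_nonneg_of_le (hfm y) (Real.exp K) (fun x => (hf0 x y).le) fun x =>
      (Real.le_exp_log _).trans (Real.exp_le_exp.2 (le_of_abs_le (hK x y)))
  -- the threshold is `exp (n r')`
  obtain ⟨r', hr1, hr2⟩ := exists_between hr
  have hlim : Filter.Tendsto (fun n : ℕ => Real.exp (n * (r' - r))) Filter.atTop Filter.atTop :=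
    Real.tendsto_exp_atTop.comp
      (tendsto_natCast_atTop_atTop.atTop_mul_const (sub_pos.2 hr1))
  filter_upwards [eventually_pi_sum_le (P.prod G) hhm (fun w => hK _ _) hr2
    (show 0 < ε / 8 by positivity), hlim.eventually_ge_atTop (64 / ε)] with n hn hnM
  let W : (Fin n → 𝒳) → (Fin n → 𝒴) → ℝ := fun x y =>
    (Measure.pi fun i => G.map (out (x i))).real {y}
  let F : (Fin n → 𝒳) → (Fin n → 𝒴) → ℝ := fun x y => ∏ i, f (x i) (y i)
  have houtn : ∀ x : Fin n → 𝒳, Measurable fun (ω : Fin n → Ω) i => out (x i) (ω i) := fun x =>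
    measurable_pi_lambda _ fun i => (houtx _).comp (measurable_pi_apply i)
  have hpush : ∀ (x : Fin n → 𝒳) (B : Set (Fin n → 𝒴)),
      (Measure.pi fun i => G.map (out (x i))).real B =
        (Measure.pi fun _ : Fin n => G).real {ω | (fun i => out (x i) (ω i)) ∈ B} := by
    intro x B
    rw [← Measure.pi_map_pi (f := fun i => out (x i)) fun i => (houtx _).aemeasurable,
      map_measureReal_apply (houtn x) B.toFinite.measurableSet]
    rfl
  have houtu : Measurable fun v : (Fin n → 𝒳) × (Fin n → Ω) => fun i => out (v.1 i) (v.2 i) :=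
    measurable_pi_lambda _ fun i =>
      have h2 : Measurable fun v : (Fin n → 𝒳) × (Fin n → Ω) => (v.1 i, v.2 i) :=
        ((measurable_pi_apply i).comp measurable_fst).prodMk
          ((measurable_pi_apply i).comp measurable_snd)
      hout.comp h2
  have hsec : ∀ B : Set ((Fin n → 𝒳) × (Fin n → Ω)), MeasurableSet B →
      Measurable fun x => (Measure.pi fun _ : Fin n => G).real {ω | (x, ω) ∈ B} := fun B hB =>
    (measurable_measure_prodMk_left hB).ennreal_toReal
  have hWm : ∀ y, Measurable fun x => W x y := fun y => by
    simp only [W, hpush]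
    exact hsec {v | (fun i => out (v.1 i) (v.2 i)) ∈ ({y} : Set (Fin n → 𝒴))}
      (houtu (measurableSet_singleton y))
  have hFm : ∀ y, Measurable fun x => F x y := fun y =>
    Finset.measurable_prod _ fun i _ => (hfm (y i)).comp (measurable_pi_apply i)
  have hFpos : ∀ x y, 0 < F x y := fun x y => Finset.prod_pos fun i _ => hf0 _ _
  have hFu : Measurable fun w : (Fin n → 𝒳) × (Fin n → 𝒴) => F w.1 w.2 :=
    measurable_from_prod_countable_left hFm
  have hp : ∫ x, ∑ y, (if F x y ≤ Real.exp (n * r') then W x y else 0)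
      ∂(Measure.pi fun _ : Fin n => P) ≤ ε / 8 := by
    let B : Set ((Fin n → 𝒳) × (Fin n → Ω)) :=
      {v | F v.1 (fun i => out (v.1 i) (v.2 i)) ≤ Real.exp (n * r')}
    have hB : MeasurableSet B :=
      measurableSet_le (hFu.comp (measurable_fst.prodMk houtu)) measurable_const
    have e1 : ∀ x, ∑ y, (if F x y ≤ Real.exp (n * r') then W x y else 0) =
        ((Measure.pi fun _ : Fin n => G) (Prod.mk x ⁻¹' B)).toReal := fun x => by
      simp only [W]
      rw [sum_ite_measureReal_singleton, hpush]
      rfl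
    simp_rw [e1]
    rw [integral_toReal (measurable_measure_prodMk_left hB).aemeasurable
      (Filter.Eventually.of_forall fun x => measure_lt_top _ _), ← Measure.prod_apply hB]
    have hmp := measurePreserving_arrowProdEquivProdArrow 𝒳 Ω (Fin n) (fun _ => P) (fun _ => G)
    rw [← hmp.measure_preimage hB.nullMeasurableSet]
    refine le_trans (le_of_eq ?_) hn
    rw [measureReal_def]
    congr 2
    ext v
    have e2 : F (fun i => (v i).1) (fun i => out (v i).1 (v i).2) =
        Real.exp (∑ i, h (v i)) := by
      rw [Real.exp_sum]
      exact Finset.prod_congr rfl fun i _ => (Real.exp_log (hf0 _ _)).symm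
    change F (fun i => (v i).1) (fun i => out (v i).1 (v i).2) ≤ _ ↔ _
    rw [e2, Real.exp_le_exp]
    rfl
  -- `⌈exp (n r)⌉ ≤ 2 exp (n r)`, and the gap `r' - r` in the exponent absorbs the constant
  have hM : ((⌈Real.exp (n * r)⌉₊ : ℕ) : ℝ) ≤ ε * Real.exp (n * r') / 32 := by
    have h1 : 1 ≤ Real.exp (n * r) := Real.one_le_exp (by positivity)
    have h2 := (Nat.ceil_lt_add_one (Real.exp_pos (n * r)).le).le
    rw [show (n : ℝ) * r' = n * r + n * (r' - r) by ring, Real.exp_add]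
    rw [div_le_iff₀ hε] at hnM
    nlinarith
  obtain ⟨enc, dec, h1, h2⟩ := exists_code_of_threshold (Measure.pi fun _ : Fin n => P) W F hWm
    (fun x y => measureReal_nonneg)
    (fun x => by
      simp only [W]
      rw [sum_measureReal_singleton]
      simp) hFm (fun x y => (hFpos x y).le)
    (fun y => Integrable.fintype_prod fun i => hfi (y i))
    (fun y => by
      rw [integral_fintype_prod_eq_prod (f := fun i x => f x (y i))]
      exact Finset.prod_le_one (fun i _ => integral_nonneg fun x => (hf0 _ _).le) fun i _ => hf1 _)
    (S := {x | ∀ i, x i ∈ S})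
    (by
      refine (ae_all_iff.2 fun i => ?_ : ∀ᵐ x ∂(Measure.pi fun _ : Fin n => P), ∀ i, x i ∈ S)
      exact (measurePreserving_eval (fun _ : Fin n => P) i).quasiMeasurePreserving.ae hS)
    (Real.exp_pos _) hε (Nat.ceil_pos.2 (Real.exp_pos _)) hp hM
  refine ⟨_, enc, dec, Nat.le_ceil _, fun m i => h1 m i, fun m => ?_⟩
  rw [← sum_ite_measureReal_singleton]
  exact h2 m

/-! ### Correlation regions and the Cholesky decomposition -/

lemma corrMatrix_of_lt {T : ℕ} (q : Pair T → ℝ) {j k : Fin T} (h : j < k) :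
    corrMatrix q j k = q ⟨(j, k), h⟩ := by
  simp [corrMatrix, h]

lemma corrMatrix_diag {T : ℕ} (q : Pair T → ℝ) (j : Fin T) : corrMatrix q j j = 1 := by
  simp [corrMatrix]

lemma corrMatrix_symm {T : ℕ} (q : Pair T → ℝ) (j k : Fin T) :
    corrMatrix q j k = corrMatrix q k j := by
  rcases lt_trichotomy j k with h | h | h
  · simp [corrMatrix, h, h.not_gt]
  · rw [h]
  · simp [corrMatrix, h, h.not_gt]

lemma isHermitian_corrMatrix {T : ℕ} (q : Pair T → ℝ) : (corrMatrix q).IsHermitian :=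
  Matrix.IsHermitian.ext fun j k => by simpa using corrMatrix_symm q k j

/-- The map `q ↦ Σ(q)` is affine. -/
lemma corrMatrix_combo {T : ℕ} (a b : ℝ) (q q' : Pair T → ℝ) :
    corrMatrix (a • q + b • q') =
      a • corrMatrix q + b • corrMatrix q' + (1 - a - b) • (1 : Matrix (Fin T) (Fin T) ℝ) := by
  ext j k
  rcases lt_trichotomy j k with h | h | h
  · simp [corrMatrix, h, h.ne]
  · subst h; simp [corrMatrix]
  · simp [corrMatrix, h, h.not_gt, h.ne']

lemma corrMatrix_smul {T : ℕ} (a : ℝ) (q : Pair T → ℝ) :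
    corrMatrix (a • q) = a • corrMatrix q + (1 - a) • (1 : Matrix (Fin T) (Fin T) ℝ) := by
  simpa using corrMatrix_combo a 0 q 0

lemma continuous_corrMatrix {T : ℕ} :
    Continuous (corrMatrix : (Pair T → ℝ) → Matrix (Fin T) (Fin T) ℝ) := by
  refine continuous_matrix fun j k => ?_
  rcases lt_trichotomy j k with h | h | h
  · simp only [corrMatrix, h, Matrix.of_apply, dif_pos]; fun_prop
  · subst h; simp only [corrMatrix_diag]; fun_prop
  · simp only [corrMatrix_symm _ j k]
    simp only [corrMatrix, h, Matrix.of_apply, dif_pos]; fun_prop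

lemma mem_corrRegion_iff {T : ℕ} {γ : ℝ} {q : Pair T → ℝ} :
    q ∈ corrRegion T γ ↔ ∀ x : Fin T → ℝ,
      0 ≤ x ⬝ᵥ ((corrMatrix q - (1 - γ) • (1 : Matrix (Fin T) (Fin T) ℝ)).mulVec x) := by
  have hH : (corrMatrix q - (1 - γ) • (1 : Matrix (Fin T) (Fin T) ℝ)).IsHermitian :=
    (isHermitian_corrMatrix q).sub (Matrix.IsHermitian.ext fun j k => by
      by_cases h : j = k
      · simp [h]
      · simp [h, Ne.symm h])
  unfold corrRegion
  rw [Set.mem_ofPred_eq, Matrix.posSemidef_iff_dotProduct_mulVec]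
  simp only [hH, true_and, star_trivial]

lemma isClosed_corrRegion (T : ℕ) (γ : ℝ) : IsClosed (corrRegion T γ) := by
  have : corrRegion T γ = ⋂ x : Fin T → ℝ, {q | 0 ≤ x ⬝ᵥ
      ((corrMatrix q - (1 - γ) • (1 : Matrix (Fin T) (Fin T) ℝ)).mulVec x)} := by
    ext q; simp [mem_corrRegion_iff]
  rw [this]
  refine isClosed_iInter fun x => isClosed_le continuous_const ?_
  exact continuous_const.dotProduct
    ((continuous_corrMatrix.sub continuous_const).matrix_mulVec continuous_const)

lemma convex_corrRegion (T : ℕ) (γ : ℝ) : Convex ℝ (corrRegion T γ) := by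
  intro q hq q' hq' a b ha hb hab
  change (corrMatrix (a • q + b • q') - _).PosSemidef
  have : corrMatrix (a • q + b • q') - (1 - γ) • (1 : Matrix (Fin T) (Fin T) ℝ) =
      a • (corrMatrix q - (1 - γ) • (1 : Matrix (Fin T) (Fin T) ℝ)) +
        b • (corrMatrix q' - (1 - γ) • (1 : Matrix (Fin T) (Fin T) ℝ)) := by
    rw [corrMatrix_combo]
    obtain rfl : b = 1 - a := by linarith
    module
  rw [this]
  exact (Matrix.PosSemidef.smul hq ha).add (Matrix.PosSemidef.smul hq' hb)

lemma abs_le_of_mem_corrRegion {T : ℕ} {γ : ℝ} {q : Pair T → ℝ} (hq : q ∈ corrRegion T γ)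
    (p : Pair T) : |q p| ≤ γ := by
  obtain ⟨⟨j, k⟩, hjk⟩ := p
  simp only at hjk
  rw [mem_corrRegion_iff] at hq
  -- the quadratic form at `e_j ± e_k` equals `2 γ ± 2 q_{jk}`
  have h1 := hq (Pi.single j 1 + Pi.single k 1)
  have h2 := hq (Pi.single j 1 - Pi.single k 1)
  have e1 := corrMatrix_of_lt q hjk
  have e2 := (corrMatrix_symm q k j).trans e1
  simp [Matrix.mulVec_add, Matrix.mulVec_sub, dotProduct_add, add_dotProduct, dotProduct_sub,
    sub_dotProduct, corrMatrix_diag, e1, e2, hjk.ne, hjk.ne'] at h1 h2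
  rw [abs_le]
  constructor <;> linarith

lemma corrRegion_subset_Icc (T : ℕ) (γ : ℝ) :
    corrRegion T γ ⊆ Set.Icc (fun _ => -γ) (fun _ => γ) := fun _ hq =>
  ⟨fun p => (abs_le.1 (abs_le_of_mem_corrRegion hq p)).1,
    fun p => (abs_le.1 (abs_le_of_mem_corrRegion hq p)).2⟩

lemma volume_corrRegion_lt_top (T : ℕ) (γ : ℝ) : volume (corrRegion T γ) < ∞ :=
  (measure_mono (corrRegion_subset_Icc T γ)).trans_lt isCompact_Icc.measure_lt_top

open scoped Pointwise in
/-- Scaling by `γ` maps `𝒬_1` into `𝒬_γ`. -/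
lemma smul_corrRegionOne_subset (T : ℕ) {γ : ℝ} (hγ : 0 ≤ γ) :
    γ • corrRegionOne T ⊆ corrRegion T γ := by
  rintro _ ⟨q, hq, rfl⟩
  simp only [corrRegionOne, Set.mem_iUnion] at hq
  obtain ⟨δ, hδ, hq⟩ := hq
  change (corrMatrix (γ • q) - _).PosSemidef
  have : corrMatrix (γ • q) - (1 - γ) • (1 : Matrix (Fin T) (Fin T) ℝ) =
      γ • ((corrMatrix q - (1 - δ) • (1 : Matrix (Fin T) (Fin T) ℝ)) +
        (1 - δ) • (1 : Matrix (Fin T) (Fin T) ℝ)) := by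
    rw [corrMatrix_smul]; module
  rw [this]
  exact (Matrix.PosSemidef.add hq (Matrix.PosSemidef.one.smul (by linarith [hδ.2]))).smul hγ

/-- By diagonal dominance, `𝒬_1` contains a cube around the origin. -/
lemma cube_subset_corrRegionOne (T : ℕ) :
    Set.Icc (fun _ => -(1 / (2 * (T : ℝ)))) (fun _ => 1 / (2 * (T : ℝ))) ⊆ corrRegionOne T := by
  intro q hq
  have hqa : ∀ p, |q p| ≤ 1 / (2 * (T : ℝ)) := fun p => abs_le.2 ⟨hq.1 p, hq.2 p⟩
  simp only [corrRegionOne, Set.mem_iUnion]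
  refine ⟨1 / 2, by norm_num, mem_corrRegion_iff.2 fun x => ?_⟩
  rcases Nat.eq_zero_or_pos T with rfl | hT
  · simp [dotProduct]
  have hT0 : (0 : ℝ) < T := by exact_mod_cast hT
  have hoff : ∀ j k, j ≠ k → |corrMatrix q j k| ≤ 1 / (2 * (T : ℝ)) := by
    intro j k hjk
    rcases lt_or_gt_of_ne hjk with h | h
    · rw [corrMatrix_of_lt q h]; exact hqa _
    · rw [corrMatrix_symm, corrMatrix_of_lt q h]; exact hqa _
  have hterm : ∀ j k, (if j = k then x j ^ 2 / 2 else 0) -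
      (x j ^ 2 / (4 * T) + x k ^ 2 / (4 * T)) ≤
      x j * ((corrMatrix q - (1 - 1 / 2 : ℝ) • (1 : Matrix (Fin T) (Fin T) ℝ)) j k * x k) := by
    intro j k
    by_cases h : j = k
    · subst h
      simp only [if_true, Matrix.sub_apply, Matrix.smul_apply, corrMatrix_diag, Matrix.one_apply_eq]
      have : 0 ≤ x j ^ 2 / (4 * T) := by positivity
      norm_num
      nlinarith
    · simp only [if_neg h, Matrix.sub_apply, Matrix.smul_apply, Matrix.one_apply_ne h, smul_zero,
        sub_zero, zero_sub]
      have h1 : |x j * (corrMatrix q j k * x k)| ≤ 1 / (2 * T) * ((x j ^ 2 + x k ^ 2) / 2) := by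
        rw [show x j * (corrMatrix q j k * x k) = corrMatrix q j k * (x j * x k) by ring, abs_mul]
        refine mul_le_mul (hoff j k h) ?_ (abs_nonneg _) (by positivity)
        rw [abs_le]
        constructor <;> nlinarith [sq_nonneg (x j + x k), sq_nonneg (x j - x k)]
      have h2 := neg_le_of_abs_le h1
      refine le_trans (le_of_eq ?_) h2
      field_simp
      ring
  have hsum := Finset.sum_le_sum fun j (_ : j ∈ Finset.univ) =>
    Finset.sum_le_sum fun k (_ : k ∈ Finset.univ) => hterm j k
  simp only [dotProduct, Matrix.mulVec, Finset.mul_sum]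
  refine le_trans (le_of_eq ?_) hsum
  simp only [Finset.sum_sub_distrib, Finset.sum_add_distrib, Finset.sum_ite_eq, Finset.mem_univ,
    if_true, Finset.sum_const, Finset.card_univ, Fintype.card_fin, nsmul_eq_mul,
    ← Finset.sum_div, ← Finset.mul_sum]
  field_simp
  ring

lemma volume_corrRegionOne_pos {T : ℕ} (hT : 0 < T) : 0 < volume (corrRegionOne T) := by
  refine lt_of_lt_of_le ?_ (measure_mono (cube_subset_corrRegionOne T))
  rw [Real.volume_Icc_pi, pos_iff_ne_zero, Finset.prod_ne_zero_iff]
  intro _ _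
  rw [← pos_iff_ne_zero, ENNReal.ofReal_pos, sub_pos]
  have : (0 : ℝ) < T := by exact_mod_cast hT
  have : 0 < 1 / (2 * (T : ℝ)) := by positivity
  linarith

lemma pow_mul_volume_corrRegionOne_le (T : ℕ) {γ : ℝ} (hγ : 0 ≤ γ) :
    ENNReal.ofReal (γ ^ Fintype.card (Pair T)) * volume (corrRegionOne T) ≤
      volume (corrRegion T γ) := by
  have h := measure_mono (μ := volume) (smul_corrRegionOne_subset T hγ)
  rwa [Measure.addHaar_smul_of_nonneg _ hγ, Module.finrank_fintype_fun_eq_card] at h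

lemma volume_corrRegionOne_lt_top (T : ℕ) : volume (corrRegionOne T) < ∞ := by
  have h := pow_mul_volume_corrRegionOne_le T zero_le_one
  rw [one_pow, ENNReal.ofReal_one, one_mul] at h
  exact h.trans_lt (volume_corrRegion_lt_top T 1)

lemma volume_corrRegion_pos {T : ℕ} (hT : 0 < T) {γ : ℝ} (hγ : 0 < γ) :
    0 < volume (corrRegion T γ) :=
  lt_of_lt_of_le (ENNReal.mul_pos (by simp; positivity) (volume_corrRegionOne_pos hT).ne')
    (pow_mul_volume_corrRegionOne_le T hγ.le)

/-- Almost every point of `𝒬_γ` has `Σ(q) ≻ (1 - γ) I`: the other points lie on the boundary of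
a convex set. -/
lemma ae_posDef_of_mem_corrRegion (T : ℕ) {γ : ℝ} (hγ : 0 < γ) :
    ∀ᵐ q ∂(volume.restrict (corrRegion T γ)),
      (corrMatrix q - (1 - γ) • (1 : Matrix (Fin T) (Fin T) ℝ)).PosDef := by
  have hfr : ∀ᵐ q ∂(volume : Measure (Pair T → ℝ)), q ∉ frontier (corrRegion T γ) :=
    measure_eq_zero_iff_ae_notMem.1 ((convex_corrRegion T γ).addHaar_frontier volume)
  rw [ae_restrict_iff' (isClosed_corrRegion T γ).measurableSet]
  filter_upwards [hfr] with q hq hqr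
  have hint : q ∈ interior (corrRegion T γ) := by
    by_contra h
    exact hq ⟨subset_closure hqr, h⟩
  have hev : ∀ᶠ t : ℝ in nhds 1, t • q ∈ corrRegion T γ := by
    have hc : ContinuousAt (fun t : ℝ => t • q) 1 := by fun_prop
    refine hc.eventually ?_
    have h1 : (fun t : ℝ => t • q) 1 = q := one_smul ℝ q
    rw [h1]
    exact mem_interior_iff_mem_nhds.1 hint
  -- an interior point stays in the region when stretched by some `t > 1`, and shrinking back
  -- adds a positive multiple of the identity
  obtain ⟨t, htq, ht⟩ := ((hev.filter_mono nhdsWithin_le_nhds).and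
    (self_mem_nhdsWithin (s := Set.Ioi (1 : ℝ)))).exists
  have ht1 : 1 < t := ht
  have ht0 : 0 < t := by linarith
  have hinv : t⁻¹ < 1 := inv_lt_one_of_one_lt₀ ht1
  have e : corrMatrix q - (1 - γ) • (1 : Matrix (Fin T) (Fin T) ℝ) =
      t⁻¹ • (corrMatrix (t • q) - (1 - γ) • (1 : Matrix (Fin T) (Fin T) ℝ)) +
        (γ * (1 - t⁻¹)) • (1 : Matrix (Fin T) (Fin T) ℝ) := by
    rw [corrMatrix_smul]
    match_scalars
    · field_simp
    · field_simp
      ring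
  rw [e]
  exact Matrix.PosDef.posSemidef_add (Matrix.PosSemidef.smul htq (by positivity))
    (Matrix.PosDef.one.smul (mul_pos hγ (by linarith)))

open scoped MatrixOrder Matrix.Norms.L2Operator in
/-- The Cholesky decomposition: Gram-Schmidt applied to the columns of a square root. -/
lemma exists_upperTriangular_of_posDef {T : ℕ} {S : Matrix (Fin T) (Fin T) ℝ} (hS : S.PosDef) :
    ∃ R : Matrix (Fin T) (Fin T) ℝ, (∀ l t, t < l → R l t = 0) ∧ (∀ l, 0 < R l l) ∧
      ∀ j k, ∑ l, R l j * R l k = S j k := by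
  obtain ⟨B, hB⟩ := CStarAlgebra.nonneg_iff_eq_star_mul_self.mp hS.posSemidef.nonneg
  let a : Fin T → EuclideanSpace ℝ (Fin T) := fun t => WithLp.toLp 2 fun i => B i t
  let b := InnerProductSpace.gramSchmidtOrthonormalBasis (𝕜 := ℝ)
    (by simp : Module.finrank ℝ (EuclideanSpace ℝ (Fin T)) = Fintype.card (Fin T)) a
  -- the signs make the diagonal nonnegative; the determinant shows that it does not vanish
  let s : Fin T → ℝ := fun l => if 0 ≤ inner ℝ (b l) (a l) then 1 else -1
  have hs : ∀ l, s l * s l = 1 := fun l => by simp only [s]; split_ifs <;> norm_num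
  let R : Matrix (Fin T) (Fin T) ℝ := Matrix.of fun l t => s l * inner ℝ (b l) (a t)
  have htri : ∀ l t, t < l → R l t = 0 := fun l t h => by
    simp only [R, Matrix.of_apply]
    rw [InnerProductSpace.gramSchmidtOrthonormalBasis_inv_triangular _ _ h, mul_zero]
  have hgram : ∀ j k, ∑ l, R l j * R l k = S j k := fun j k => by
    have h1 : ∀ l, R l j * R l k = inner ℝ (a j) (b l) * inner ℝ (b l) (a k) := fun l => by
      simp only [R, Matrix.of_apply]
      rw [real_inner_comm (b l) (a j)]
      linear_combination (inner ℝ (b l) (a j) * inner ℝ (b l) (a k)) * hs l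
    simp_rw [h1]
    rw [b.sum_inner_mul_inner, hB, Matrix.star_eq_conjTranspose, Matrix.mul_apply]
    simp [a, PiLp.inner_apply, mul_comm]
  have hdet : R.det ≠ 0 := by
    have h1 : R.transpose * R = S := by ext j k; rw [Matrix.mul_apply]; exact hgram j k
    have h2 := hS.det_pos
    rw [← h1, Matrix.det_mul] at h2
    exact fun h => by simp [h] at h2
  rw [Matrix.det_of_isUpperTriangular (fun l t h => htri l t h), Finset.prod_ne_zero_iff] at hdet
  refine ⟨R, htri, fun l => lt_of_le_of_ne ?_ (hdet l (Finset.mem_univ l)).symm, hgram⟩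
  simp only [R, s, Matrix.of_apply]
  split_ifs with h <;> linarith

/-! ### A triangular input law with uniform correlations -/

lemma measurable_corr {nt T : ℕ} : Measurable (corr : Mat nt T → Pair T → ℝ) := by
  refine measurable_pi_lambda _ fun p => ?_
  unfold corr
  fun_prop

/-- The matrices of `triInputSet` with a positive diagonal. On this set the correlation vector
determines the input, by uniqueness of the Cholesky decomposition. -/
def triPosSet (nt T : ℕ) (snr : ℝ) : Set (Mat nt T) :=
  triInputSet nt T snr ∩ {X | ∀ (l : Fin nt) (t : Fin T), (l : ℕ) = (t : ℕ) → 0 < X l t}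

lemma measurableSet_triPosSet (nt T : ℕ) (snr : ℝ) : MeasurableSet (triPosSet nt T snr) := by
  have hm : ∀ (l : Fin nt) (t : Fin T), Measurable fun X : Mat nt T => X l t := fun l t => by
    fun_prop
  have e : triPosSet nt T snr = (⋂ t, {X | ∑ l, X l t ^ 2 = snr}) ∩
      (⋂ (l : Fin nt) (t : Fin T), {X | (t : ℕ) < (l : ℕ) → X l t = 0}) ∩
      (⋂ (l : Fin nt) (t : Fin T), {X | (l : ℕ) = (t : ℕ) → 0 ≤ X l t}) ∩
      (⋂ (l : Fin nt) (t : Fin T), {X | (l : ℕ) = (t : ℕ) → 0 < X l t}) := by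
    ext X
    simp [triPosSet, triInputSet, and_assoc]
  rw [e]
  refine (((MeasurableSet.iInter fun t => ?_).inter (.iInter fun l => .iInter fun t => ?_)).inter
    (.iInter fun l => .iInter fun t => ?_)).inter (.iInter fun l => .iInter fun t => ?_)
  · exact measurableSet_eq_fun (by fun_prop) measurable_const
  · exact (MeasurableSet.const _).imp (measurableSet_eq_fun (hm l t) measurable_const)
  · exact (MeasurableSet.const _).imp (measurableSet_le measurable_const (hm l t))
  · exact (MeasurableSet.const _).imp (measurableSet_lt measurable_const (hm l t))

lemma corr_of_norm_eq {nt T : ℕ} {snr : ℝ} (hsnr : 0 < snr) {X : Mat nt T}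
    (hX : ∀ t, ∑ l, X l t ^ 2 = snr) (p : Pair T) :
    corr X p = (∑ l, X l p.1.1 * X l p.1.2) / (1 + snr) := by
  rw [corr, hX, hX, Real.sqrt_mul_self (by positivity)]

lemma injOn_corr_triPosSet {nt T : ℕ} {snr : ℝ} (hsnr : 0 < snr) :
    Set.InjOn corr (triPosSet nt T snr) := by
  intro X hX Y hY hXY
  obtain ⟨⟨hXn, hXt, -⟩, hXp⟩ := hX
  obtain ⟨⟨hYn, hYt, -⟩, hYp⟩ := hY
  have hlt : ∀ j k : Fin T, j < k → ∑ l, X l j * X l k = ∑ l, Y l j * Y l k := fun j k h => by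
    have := congrFun hXY ⟨(j, k), h⟩
    rw [corr_of_norm_eq hsnr hXn, corr_of_norm_eq hsnr hYn] at this
    exact (div_left_inj' (by positivity)).1 this
  have hgram : ∀ j k : Fin T, ∑ l, X l j * X l k = ∑ l, Y l j * Y l k := fun j k => by
    rcases lt_trichotomy j k with h | h | h
    · exact hlt j k h
    · subst h
      simp_rw [← sq]
      rw [hXn, hYn]
    · have := hlt k j h
      simpa only [mul_comm] using this
  -- the rows are recovered one after the other
  have main : ∀ (n : ℕ) (l : Fin nt), (l : ℕ) = n → ∀ t, X l t = Y l t := by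
    intro n
    induction n using Nat.strong_induction_on with
    | _ n ih =>
      intro l hl t
      by_cases hlT : (l : ℕ) < T
      · let u : Fin T := ⟨l, hlT⟩
        have hrow : ∀ k, X l u * X l k = Y l u * Y l k := fun k => by
          have h1 : ∑ i, (X i u * X i k - Y i u * Y i k) = X l u * X l k - Y l u * Y l k := by
            refine Finset.sum_eq_single l (fun i _ hil => ?_) (by simp)
            rcases lt_or_gt_of_ne (fun h => hil (Fin.ext h) : (i : ℕ) ≠ l) with h | h
            · rw [ih i (hl ▸ h) i rfl u, ih i (hl ▸ h) i rfl k, sub_self]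
            · rw [hXt i u h, hYt i u h]; simp
          rw [Finset.sum_sub_distrib, hgram, sub_self] at h1
          linarith
        have hxu := hXp l u rfl
        have hyu := hYp l u rfl
        have hdiag : X l u = Y l u := by
          have := hrow u
          nlinarith
        have := hrow t
        rw [hdiag] at this
        exact mul_left_cancel₀ hyu.ne' this
      · have : (t : ℕ) < l := t.2.trans_le (not_lt.1 hlT)
        rw [hXt l t this, hYt l t this]
  ext l t
  exact main l l rfl t

lemma exists_mem_triPosSet {nt T : ℕ} {snr : ℝ} (hnt : T ≤ nt) (hsnr : 0 < snr) {q : Pair T → ℝ}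
    (hq : (corrMatrix q - (1 - gam snr) • (1 : Matrix (Fin T) (Fin T) ℝ)).PosDef) :
    ∃ X ∈ triPosSet nt T snr, corr X = q := by
  have hs : 0 < 1 + snr := by positivity
  obtain ⟨R, htri, hpos, hgram⟩ := exists_upperTriangular_of_posDef (hq.smul hs)
  let X : Mat nt T := fun l t => if h : (l : ℕ) < T then R ⟨l, h⟩ t else 0
  have hXgram : ∀ j k, ∑ l, X l j * X l k =
      ((1 + snr) • (corrMatrix q - (1 - gam snr) • (1 : Matrix (Fin T) (Fin T) ℝ))) j k := by
    intro j k
    rw [← hgram j k]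
    refine (Fintype.sum_of_injective (Fin.castLE hnt) (Fin.castLE_injective hnt) _ _
      (fun l hl => ?_) fun i => ?_).symm
    · have : ¬ (l : ℕ) < T := fun h => hl ⟨⟨l, h⟩, rfl⟩
      simp [X, this]
    · simp [X]
  have hγ : (1 + snr) * gam snr = snr := by unfold gam; field_simp
  have hnorm : ∀ t, ∑ l, X l t ^ 2 = snr := fun t => by
    simp_rw [sq]
    rw [hXgram, Matrix.smul_apply, Matrix.sub_apply, corrMatrix_diag, Matrix.smul_apply,
      Matrix.one_apply_eq]
    simp only [smul_eq_mul]
    linear_combination hγ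
  have hXpos : ∀ (l : Fin nt) (t : Fin T), (l : ℕ) = (t : ℕ) → 0 < X l t := fun l t h => by
    have hlT : (l : ℕ) < T := h ▸ t.2
    have : (⟨l, hlT⟩ : Fin T) = t := Fin.ext h
    simp only [X, dif_pos hlT, this]
    exact hpos t
  refine ⟨X, ⟨⟨hnorm, fun l t h => ?_, fun l t h => (hXpos l t h).le⟩, hXpos⟩, ?_⟩
  · by_cases hlT : (l : ℕ) < T
    · simp only [X, dif_pos hlT]
      exact htri _ _ h
    · simp only [X, dif_neg hlT]
  · ext p
    rw [corr_of_norm_eq hsnr hnorm, hXgram, Matrix.smul_apply, Matrix.sub_apply,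
      corrMatrix_of_lt q p.2, Matrix.smul_apply, Matrix.one_apply_ne p.2.ne]
    simp only [smul_eq_mul, mul_zero, sub_zero]
    rw [mul_div_cancel_left₀ _ hs.ne']

lemma gam_pos {snr : ℝ} (hsnr : 0 < snr) : 0 < gam snr := by unfold gam; positivity

lemma isProbabilityMeasure_cond_corrRegion {T : ℕ} (hT : 0 < T) {γ : ℝ} (hγ : 0 < γ) :
    IsProbabilityMeasure (ProbabilityTheory.cond volume (corrRegion T γ)) :=
  cond_isProbabilityMeasure_of_finite (volume_corrRegion_pos hT hγ).ne'
    (volume_corrRegion_lt_top T γ).ne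

/-- An input law of triangular form that makes the correlation vector uniform on `𝒬_γ`: the
uniform law pulled back along the correlation map, which embeds the triangular matrices with
positive diagonal onto almost all of `𝒬_γ`. -/
theorem exists_triangular_law {nt T : ℕ} {snr : ℝ} (hT : 0 < T) (hnt : T ≤ nt) (hsnr : 0 < snr) :
    ∃ P : Measure (Mat nt T), IsProbabilityMeasure P ∧ (∀ᵐ X ∂P, X ∈ triInputSet nt T snr) ∧
      P.map corr = ProbabilityTheory.cond volume (corrRegion T (gam snr)) := by
  set ν := ProbabilityTheory.cond volume (corrRegion T (gam snr)) with hν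
  have hνp : IsProbabilityMeasure ν := isProbabilityMeasure_cond_corrRegion hT (gam_pos hsnr)
  have hD := measurableSet_triPosSet nt T snr
  have : StandardBorelSpace (triPosSet nt T snr) := hD.standardBorel
  let g : triPosSet nt T snr → Pair T → ℝ := fun X => corr X.1
  have hg : MeasurableEmbedding g :=
    (measurable_corr.comp measurable_subtype_coe).measurableEmbedding fun X Y h =>
      Subtype.ext (injOn_corr_triPosSet hsnr X.2 Y.2 h)
  have hrange : ∀ᵐ q ∂ν, q ∈ Set.range g := by
    rw [hν, ProbabilityTheory.cond]
    refine Measure.ae_smul_measure ?_ _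
    filter_upwards [ae_posDef_of_mem_corrRegion T (gam_pos hsnr)] with q hq
    obtain ⟨X, hX, hXq⟩ := exists_mem_triPosSet hnt hsnr hq
    exact ⟨⟨X, hX⟩, hXq⟩
  let P : Measure (Mat nt T) := (ν.comap g).map Subtype.val
  have hmap : P.map corr = ν := by
    rw [Measure.map_map measurable_corr measurable_subtype_coe]
    change (ν.comap g).map g = ν
    rw [hg.map_comap, Measure.restrict_eq_self_of_ae_mem hrange]
  have hP : IsProbabilityMeasure P := by
    rw [← hmap] at hνp
    exact Measure.isProbabilityMeasure_of_map corr
  refine ⟨P, hP, ?_, hmap⟩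
  have : ∀ᵐ X ∂P, X ∈ triPosSet nt T snr :=
    (ae_map_iff (p := (· ∈ triPosSet nt T snr)) measurable_subtype_coe.aemeasurable hD).2
      (Filter.Eventually.of_forall fun X => X.2)
  filter_upwards [this] with X hX using hX.1

/-! ### The Gaussian score -/

lemma measurable_uncurry_output {nt nr T : ℕ} : Measurable
    (Function.uncurry (output : Mat nt T → Mat nr nt × Mat nr T → Output nr T)) := by
  refine measurable_pi_lambda _ fun k => measurable_pi_lambda _ fun t => measurable_sgn.comp ?_
  fun_prop

lemma measurable_corrEstimate {nr T : ℕ} :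
    Measurable (corrEstimate : Output nr T → Pair T → ℝ) :=
  measurable_of_countable _

lemma abs_corrEstimate_le_one {nr T : ℕ} (Y : Output nr T) (p : Pair T) :
    |corrEstimate Y p| ≤ 1 := Real.abs_cos_le_one _

/-- The score of a pair of correlation vectors: the density, relative to the uniform law on a
region of volume `v`, of a product of normal laws of variance `s` centred at the estimate `c`. -/
noncomputable def score {T : ℕ} (v : ℝ) (s : ℝ≥0) (q c : Pair T → ℝ) : ℝ :=
  v * ∏ p, gaussianPDFReal (c p) s (q p)

lemma score_pos {T : ℕ} {v : ℝ} (hv : 0 < v) {s : ℝ≥0} (hs : s ≠ 0) (q c : Pair T → ℝ) :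
    0 < score v s q c :=
  mul_pos hv (Finset.prod_pos fun _ _ => gaussianPDFReal_pos _ _ _ hs)

lemma measurable_score {T : ℕ} (v : ℝ) (s : ℝ≥0) :
    Measurable fun w : (Pair T → ℝ) × (Pair T → ℝ) => score v s w.1 w.2 := by
  refine measurable_const.mul (Finset.measurable_prod _ fun p _ => ?_)
  unfold gaussianPDFReal
  fun_prop

lemma score_le {T : ℕ} {v : ℝ} (hv : 0 < v) (s : ℝ≥0) (q c : Pair T → ℝ) :
    score v s q c ≤ v * ∏ _p : Pair T, (√(2 * Real.pi * s))⁻¹ := by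
  refine mul_le_mul_of_nonneg_left (Finset.prod_le_prod
    (fun p _ => gaussianPDFReal_nonneg _ _ _) fun p _ => ?_) hv.le
  unfold gaussianPDFReal
  refine mul_le_of_le_one_right (by positivity) (Real.exp_le_one_iff.2 ?_)
  rw [neg_div, neg_nonpos]
  positivity

lemma log_score {T : ℕ} {v : ℝ} (hv : 0 < v) {s : ℝ≥0} (hs : s ≠ 0) (q c : Pair T → ℝ) :
    Real.log (score v s q c) = Real.log v - Fintype.card (Pair T) / 2 * Real.log (2 * Real.pi * s) -
      ∑ p, (q p - c p) ^ 2 / (2 * s) := by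
  have hs0 : (0 : ℝ) < s := by positivity
  have h1 : ∀ p, Real.log (gaussianPDFReal (c p) s (q p)) =
      -(1 / 2) * Real.log (2 * Real.pi * s) - (q p - c p) ^ 2 / (2 * s) := fun p => by
    unfold gaussianPDFReal
    rw [Real.log_mul (by positivity) (Real.exp_pos _).ne', Real.log_exp, Real.log_inv,
      Real.log_sqrt (by positivity)]
    ring
  rw [score, Real.log_mul hv.ne'
    (Finset.prod_pos fun _ _ => gaussianPDFReal_pos _ _ _ hs).ne',
    Real.log_prod fun _ _ => (gaussianPDFReal_pos _ _ _ hs).ne']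
  simp_rw [h1]
  rw [Finset.sum_sub_distrib]
  simp only [Finset.sum_const, Finset.card_univ, nsmul_eq_mul]
  ring

lemma abs_log_score_le {T : ℕ} {v : ℝ} (hv : 0 < v) {s : ℝ≥0} (hs : s ≠ 0) {q c : Pair T → ℝ}
    (hq : ∀ p, |q p| ≤ 1) (hc : ∀ p, |c p| ≤ 1) :
    |Real.log (score v s q c)| ≤
      |Real.log v - Fintype.card (Pair T) / 2 * Real.log (2 * Real.pi * s)| +
        ∑ _p : Pair T, 4 / (2 * (s : ℝ)) := by
  rw [log_score hv hs]
  refine (abs_sub _ _).trans (add_le_add_right ?_ _)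
  rw [abs_of_nonneg (Finset.sum_nonneg fun p _ => by positivity)]
  refine Finset.sum_le_sum fun p _ => ?_
  have h1 := abs_le.1 (hq p)
  have h2 := abs_le.1 (hc p)
  gcongr
  nlinarith

/-- A product of normal densities integrates to at most one over any region. -/
lemma integral_score_cond_le_one {T : ℕ} {Q : Set (Pair T → ℝ)} (hQ0 : 0 < volume Q)
    (hQ : volume Q < ∞) {s : ℝ≥0} (hs : s ≠ 0) (c : Pair T → ℝ) :
    ∫ q, score (volume.real Q) s q c ∂(ProbabilityTheory.cond volume Q) ≤ 1 := by
  have hv : 0 < volume.real Q := ENNReal.toReal_pos hQ0.ne' hQ.ne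
  have hint : Integrable (fun q : Pair T → ℝ => ∏ p, gaussianPDFReal (c p) s (q p)) :=
    Integrable.fintype_prod fun p => integrable_gaussianPDFReal (c p) s
  have h1 : ∫ q in Q, ∏ p, gaussianPDFReal (c p) s (q p) ≤ 1 := by
    calc _ ≤ ∫ q : Pair T → ℝ, ∏ p, gaussianPDFReal (c p) s (q p) :=
          setIntegral_le_integral hint (Filter.Eventually.of_forall fun q =>
            Finset.prod_nonneg fun p _ => gaussianPDFReal_nonneg _ _ _)
      _ = 1 := by
          rw [volume_pi, integral_fintype_prod_eq_prod (f := fun p x => gaussianPDFReal (c p) s x)]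
          simp [integral_gaussianPDFReal_eq_one _ hs]
  rw [ProbabilityTheory.cond, integral_smul_measure]
  simp only [score]
  rw [integral_const_mul, ENNReal.toReal_inv, smul_eq_mul, ← measureReal_def,
    inv_mul_cancel_left₀ hv.ne']
  exact h1

/-- The variance of the normal laws in the score, an upper bound for the mean square error of the
estimate. -/
noncomputable def errVar (nr : ℕ) : ℝ≥0 := ⟨Real.pi ^ 2 / nr, by positivity⟩

lemma errVar_ne_zero {nr : ℕ} (hnr : 1 ≤ nr) : errVar nr ≠ 0 := by
  have h : (0 : ℝ) < nr := by exact_mod_cast hnr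
  have h2 : (0 : ℝ) < Real.pi ^ 2 / nr := div_pos (pow_pos Real.pi_pos 2) h
  exact fun h0 => h2.ne' (congrArg NNReal.toReal h0)

lemma two_mul_card_pair (T : ℕ) : (2 * Fintype.card (Pair T) : ℝ) = T * (T - 1) := by
  have h2 : Fintype.card (Pair T) + Fintype.card (Pair T) + T = T * T := by
    have e1 : Fintype.card {p : Fin T × Fin T // p.2 < p.1} = Fintype.card (Pair T) :=
      Fintype.card_congr ((Equiv.prodComm _ _).subtypeEquiv fun _ => Iff.rfl)
    have e2 : Fintype.card {p : Fin T × Fin T // p.1 = p.2} = T := by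
      rw [Fintype.card_congr (Equiv.subtypeProdEquivSigmaSubtype fun a b : Fin T => a = b)]
      simp
    have e3 := Finset.card_univ (α := Fin T × Fin T)
    have e4 : (Finset.univ : Finset (Fin T × Fin T)) =
        (Finset.univ.filter fun p => p.1 < p.2) ∪ (Finset.univ.filter fun p => p.2 < p.1) ∪
          (Finset.univ.filter fun p => p.1 = p.2) := by
      ext p
      rcases lt_trichotomy p.1 p.2 with h | h | h <;> simp [h]
    rw [e4, Finset.card_union_of_disjoint, Finset.card_union_of_disjoint,
      ← Fintype.card_subtype, ← Fintype.card_subtype, ← Fintype.card_subtype, e1, e2,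
      Fintype.card_prod, Fintype.card_fin] at e3
    · exact e3
    · rw [Finset.disjoint_filter]
      exact fun p _ h => h.not_gt
    · rw [Finset.disjoint_left]
      intro p hp hp'
      simp at hp hp'
      rw [hp'] at hp
      simp at hp
  have h3 : (Fintype.card (Pair T) + Fintype.card (Pair T) + T : ℝ) = T * T := by exact_mod_cast h2
  linarith

/-! ### The rate bound -/

/-- The score attached to the uniform law on `𝒬_γ` and `nr` antennas. -/
noncomputable def channelScore {T : ℕ} (nr : ℕ) (snr : ℝ) (q c : Pair T → ℝ) : ℝ :=
  score (volume.real (corrRegion T (gam snr))) (errVar nr) q c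

lemma measurable_channelScore {T : ℕ} (nr : ℕ) (snr : ℝ) :
    Measurable fun w : (Pair T → ℝ) × (Pair T → ℝ) => channelScore nr snr w.1 w.2 :=
  measurable_score _ _

lemma measurable_channelScore_left {T : ℕ} (nr : ℕ) (snr : ℝ) (c : Pair T → ℝ) :
    Measurable fun q => channelScore nr snr q c :=
  measurable_const.mul (Finset.measurable_prod _ fun p _ =>
    (measurable_gaussianPDFReal _ _).comp (measurable_pi_apply p))

lemma volume_real_corrRegion_pos {T : ℕ} (hT : 0 < T) {γ : ℝ} (hγ : 0 < γ) :
    0 < volume.real (corrRegion T γ) :=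
  ENNReal.toReal_pos (volume_corrRegion_pos hT hγ).ne' (volume_corrRegion_lt_top T γ).ne

/-- The rate bound in nats per block, in terms of `𝒬_γ` instead of `𝒬_1`. -/
lemma mul_rateBound_le {nr T : ℕ} (hT : 0 < T) (hnr : 1 ≤ nr) {snr : ℝ} (hsnr : 0 < snr) :
    T * rateBound nr T snr * Real.log 2 ≤
      Real.log (volume.real (corrRegion T (gam snr))) -
        Fintype.card (Pair T) / 2 * Real.log (2 * Real.pi * errVar nr) -
        Fintype.card (Pair T) / 2 := by
  have hT0 : (0 : ℝ) < T := by exact_mod_cast hT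
  have hnr0 : (0 : ℝ) < nr := by exact_mod_cast hnr
  have hγ := gam_pos hsnr
  have hπ := Real.pi_pos
  have hl2 : 0 < Real.log 2 := Real.log_pos one_lt_two
  have hv1 : 0 < volume.real (corrRegionOne T) :=
    ENNReal.toReal_pos (volume_corrRegionOne_pos hT).ne' (volume_corrRegionOne_lt_top T).ne
  have hvol : gam snr ^ Fintype.card (Pair T) * volume.real (corrRegionOne T) ≤
      volume.real (corrRegion T (gam snr)) := by
    have := ENNReal.toReal_mono (volume_corrRegion_lt_top T (gam snr)).ne
      (pow_mul_volume_corrRegionOne_le T hγ.le)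
    rwa [ENNReal.toReal_mul, ENNReal.toReal_ofReal (by positivity)] at this
  have hlogvol : Fintype.card (Pair T) * Real.log (gam snr) +
      Real.log (volume.real (corrRegionOne T)) ≤
      Real.log (volume.real (corrRegion T (gam snr))) := by
    rw [← Real.log_pow, ← Real.log_mul (by positivity) hv1.ne']
    exact Real.log_le_log (by positivity) hvol
  have hcard := two_mul_card_pair T
  have e1 : Real.log (gam snr ^ 2 / (2 * Real.pi ^ 3 * Real.exp 1) * nr) =
      2 * Real.log (gam snr) - Real.log (2 * Real.pi * errVar nr) - 1 := by
    have : gam snr ^ 2 / (2 * Real.pi ^ 3 * Real.exp 1) * nr =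
        gam snr ^ 2 / (2 * Real.pi * errVar nr) / Real.exp 1 := by
      change _ = gam snr ^ 2 / (2 * Real.pi * (Real.pi ^ 2 / nr)) / Real.exp 1
      field_simp
    have hs : (0 : ℝ) < 2 * Real.pi * errVar nr := by
      have := errVar_ne_zero hnr
      positivity
    rw [this, Real.log_div (by positivity) (Real.exp_pos 1).ne', Real.log_exp,
      Real.log_div (by positivity) hs.ne', Real.log_pow]
    push_cast
    ring
  have e2 : T * rateBound nr T snr * Real.log 2 =
      (T * (T - 1)) / 4 * Real.log (gam snr ^ 2 / (2 * Real.pi ^ 3 * Real.exp 1) * nr) +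
        Real.log (volume.real (corrRegionOne T)) := by
    unfold rateBound Real.logb
    field_simp
  rw [e2, e1, ← hcard]
  linarith

section Channel

variable {nt nr T : ℕ} {snr : ℝ}

lemma channelScore_pos (hT : 0 < T) (hnr : 1 ≤ nr) (hsnr : 0 < snr) (q c : Pair T → ℝ) :
    0 < channelScore nr snr q c :=
  score_pos (volume_real_corrRegion_pos hT (gam_pos hsnr)) (errVar_ne_zero hnr) q c

lemma exists_abs_log_channelScore_le (hT : 0 < T) (hnr : 1 ≤ nr) (hsnr : 0 < snr) :
    ∃ K : ℝ, ∀ (X : Mat nt T) (Y : Output nr T),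
      |Real.log (channelScore nr snr (corr X) (corrEstimate Y))| ≤ K :=
  ⟨_, fun X Y => abs_log_score_le (volume_real_corrRegion_pos hT (gam_pos hsnr))
    (errVar_ne_zero hnr) (fun p => (abs_corr_lt_one X p).le) (abs_corrEstimate_le_one Y)⟩

lemma measurable_corrPair : Measurable fun w : Mat nt T × (Mat nr nt × Mat nr T) =>
    (corr w.1, corrEstimate (output w.1 w.2)) :=
  (measurable_corr.comp measurable_fst).prodMk
    (measurable_corrEstimate.comp measurable_uncurry_output)

/-- The mean logarithmic score is at least the rate bound, in nats per block, whatever the input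
law: only the mean square error of the estimate enters. -/
lemma mul_rateBound_le_integral_log_channelScore (hT : 0 < T) (hnr : 1 ≤ nr) (hsnr : 0 < snr)
    (P : Measure (Mat nt T)) [IsProbabilityMeasure P] :
    T * rateBound nr T snr * Real.log 2 ≤
      ∫ w, Real.log (channelScore nr snr (corr w.1) (corrEstimate (output w.1 w.2)))
        ∂(P.prod ((gaussianMatrix nr nt).prod (gaussianMatrix nr T))) := by
  refine (mul_rateBound_le hT hnr hsnr).trans ?_
  set G := (gaussianMatrix nr nt).prod (gaussianMatrix nr T)
  set s := errVar nr with hs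
  have hs0 : (0 : ℝ) < s := by
    have := errVar_ne_zero hnr
    positivity
  have hint : ∀ p : Pair T, Integrable (fun w : Mat nt T × (Mat nr nt × Mat nr T) =>
      (corr w.1 p - corrEstimate (output w.1 w.2) p) ^ 2) (P.prod G) := fun p => by
    have hm : Measurable fun w : Mat nt T × (Mat nr nt × Mat nr T) =>
        (corr w.1 p - corrEstimate (output w.1 w.2) p) ^ 2 :=
      (((measurable_pi_apply p).comp (measurable_fst.comp measurable_corrPair)).sub
        ((measurable_pi_apply p).comp (measurable_snd.comp measurable_corrPair))).pow_const 2
    refine integrable_of_nonneg_of_le hm 4 (fun w => sq_nonneg _) fun w => ?_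
    have h1 := abs_le.1 (abs_corr_lt_one w.1 p).le
    have h2 := abs_le.1 (abs_corrEstimate_le_one (output w.1 w.2) p)
    nlinarith
  have hmse : ∀ p : Pair T, ∫ w : Mat nt T × (Mat nr nt × Mat nr T),
      (corr w.1 p - corrEstimate (output w.1 w.2) p) ^ 2 ∂(P.prod G) ≤ s := fun p => by
    rw [integral_prod _ (hint p)]
    calc _ ≤ ∫ _X : Mat nt T, (s : ℝ) ∂P :=
          integral_mono (hint p).integral_prod_left (integrable_const _) fun X =>
            integral_sq_corr_sub_corrEstimate_le hnr X p
      _ = s := by simp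
  simp only [channelScore]
  simp_rw [log_score (volume_real_corrRegion_pos hT (gam_pos hsnr)) (errVar_ne_zero hnr)]
  rw [integral_sub (integrable_const _)
      (integrable_finsetSum _ fun p _ => (hint p).div_const _), integral_const, probReal_univ,
    one_smul, integral_finsetSum _ fun p _ => (hint p).div_const _]
  refine sub_le_sub_left ?_ _
  calc _ ≤ ∑ _p : Pair T, (s : ℝ) / (2 * s) := by
        refine Finset.sum_le_sum fun p _ => ?_
        rw [integral_div]
        exact div_le_div_of_nonneg_right (hmse p) (by positivity)
    _ = Fintype.card (Pair T) / 2 := by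
        simp only [Finset.sum_const, Finset.card_univ, nsmul_eq_mul]
        field_simp

/-- Every rate below the bound is achievable. -/
lemma achievable_of_lt_rateBound (hT : 0 < T) (hnt : T ≤ nt) (hnr : 1 ≤ nr) (hsnr : 0 < snr)
    {R : ℝ} (hR0 : 0 ≤ R) (hR : R < rateBound nr T snr) : Achievable nt nr T snr R := by
  intro ε hε
  obtain ⟨P, hP, htri, hmap⟩ := exists_triangular_law hT hnt hsnr
  obtain ⟨K, hK⟩ := exists_abs_log_channelScore_le (nt := nt) hT hnr hsnr
  have hT0 : (0 : ℝ) < T := by exact_mod_cast hT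
  have hl2 : 0 < Real.log 2 := Real.log_pos one_lt_two
  let f : Mat nt T → Output nr T → ℝ := fun X Y => channelScore nr snr (corr X) (corrEstimate Y)
  have hf1 : ∀ Y, ∫ X, f X Y ∂P ≤ 1 := fun Y => by
    have h := integral_map (μ := P) (f := fun q => channelScore nr snr q (corrEstimate Y))
      measurable_corr.aemeasurable (measurable_channelScore_left nr snr _).aestronglyMeasurable
    refine h.symm.le.trans ?_
    rw [hmap]
    exact integral_score_cond_le_one (volume_corrRegion_pos hT (gam_pos hsnr))
      (volume_corrRegion_lt_top _ _) (errVar_ne_zero hnr) _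
  have hin : ∀ᵐ X ∂P, X ∈ inputSet nt T snr := htri.mono fun X hX t => (hX.1 t).le
  have hrate : T * R * Real.log 2 < ∫ w, Real.log (f w.1 (output w.1 w.2))
      ∂(P.prod ((gaussianMatrix nr nt).prod (gaussianMatrix nr T))) :=
    lt_of_lt_of_le (by gcongr) (mul_rateBound_le_integral_log_channelScore hT hnr hsnr P)
  have hcode := eventually_exists_block_code P
    ((gaussianMatrix nr nt).prod (gaussianMatrix nr T)) output
    measurable_uncurry_output f
    (fun Y => (measurable_channelScore_left nr snr _).comp measurable_corr)
    (fun X Y => channelScore_pos hT hnr hsnr _ _) hK hf1 hin (by positivity) hrate hε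
  refine hcode.mono fun n hn => ?_
  obtain ⟨M, enc, dec, h1, h2, h3⟩ := hn
  have hexp : (2 : ℝ) ^ ((n : ℝ) * T * R) = Real.exp (n * (T * R * Real.log 2)) := by
    rw [Real.rpow_def_of_pos two_pos]
    ring_nf
  exact ⟨M, enc, dec, hexp.trans_le h1, h2, h3⟩

lemma rateBound_le_capacity (hT : 0 < T) (hnt : T ≤ nt) (hnr : 1 ≤ nr) (hsnr : 0 < snr) :
    ((rateBound nr T snr : ℝ) : EReal) ≤ ((capacity nt nr T snr : ℝ≥0∞) : EReal) := by
  have h : ENNReal.ofReal (rateBound nr T snr) ≤ capacity nt nr T snr := by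
    refine ENNReal.le_of_forall_nnreal_lt fun R hR => ?_
    have hR' : (R : ℝ) < rateBound nr T snr := by
      rwa [ENNReal.lt_ofReal_iff_toReal_lt ENNReal.coe_ne_top] at hR
    exact le_iSup₂_of_le R (achievable_of_lt_rateBound hT hnt hnr hsnr R.2 hR') le_rfl
  refine le_trans ?_ (EReal.coe_ennreal_le_coe_ennreal_iff.2 h)
  rw [EReal.coe_ennreal_ofReal]
  exact EReal.coe_le_coe_iff.2 (le_max_left _ _)

lemma measurable_inputOutput : Measurable fun w : Mat nt T × (Mat nr nt × Mat nr T) =>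
    (w.1, output w.1 w.2) :=
  measurable_fst.prodMk measurable_uncurry_output

lemma map_jointLaw (P : Measure (Mat nt T)) :
    (jointLaw nr P).map (Prod.map corr corrEstimate) =
      (P.prod ((gaussianMatrix nr nt).prod (gaussianMatrix nr T))).map
        fun w => (corr w.1, corrEstimate (output w.1 w.2)) := by
  rw [jointLaw, Measure.map_map (measurable_corr.prodMap measurable_corrEstimate)
    measurable_inputOutput]
  rfl

/-- Data processing: functions of the input and of the output share no more information than the
input and the output. -/
lemma mutualInfo_map_le {α β α' β' : Type*} [MeasurableSpace α] [MeasurableSpace β]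
    [MeasurableSpace α'] [MeasurableSpace β'] (μ : Measure (α × β)) [IsFiniteMeasure μ]
    {φ : α → α'} {ψ : β → β'} (hφ : Measurable φ) (hψ : Measurable ψ) :
    mutualInfo (μ.map (Prod.map φ ψ)) ≤ mutualInfo μ := by
  have h1 : (μ.map (Prod.map φ ψ)).fst = μ.fst.map φ := by
    rw [Measure.fst, Measure.fst, Measure.map_map measurable_fst (hφ.prodMap hψ),
      Measure.map_map hφ measurable_fst]
    rfl
  have h2 : (μ.map (Prod.map φ ψ)).snd = μ.snd.map ψ := by
    rw [Measure.snd, Measure.snd, Measure.map_map measurable_snd (hφ.prodMap hψ),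
      Measure.map_map hψ measurable_snd]
    rfl
  unfold mutualInfo
  rw [h1, h2, Measure.map_prod_map _ _ hφ hψ]
  exact ENNReal.div_le_div_right
    (InformationTheory.klDiv_map_le _ _ (hφ.prodMap hψ)) _

/-- The information between the correlation vector and its estimate is at least the rate bound,
by the variational bound applied to the score. -/
lemma rateBound_le_mutualInfo (hT : 0 < T) (hnr : 1 ≤ nr) (hsnr : 0 < snr)
    (P : Measure (Mat nt T)) [IsProbabilityMeasure P]
    (hmap : P.map corr = ProbabilityTheory.cond volume (corrRegion T (gam snr))) :
    ((rateBound nr T snr : ℝ) : EReal) ≤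
      ((mutualInfo ((jointLaw nr P).map (Prod.map corr corrEstimate)) / T : ℝ≥0∞) : EReal) := by
  obtain ⟨K, hK⟩ := exists_abs_log_channelScore_le (nt := nt) hT hnr hsnr
  have hT0 : (0 : ℝ) < T := by exact_mod_cast hT
  have hl2 : 0 < Real.log 2 := Real.log_pos one_lt_two
  have hv := volume_real_corrRegion_pos hT (gam_pos hsnr)
  have hs := errVar_ne_zero hnr
  rw [map_jointLaw]
  set G := (gaussianMatrix nr nt).prod (gaussianMatrix nr T)
  set g : Mat nt T × (Mat nr nt × Mat nr T) → (Pair T → ℝ) × (Pair T → ℝ) :=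
    fun w => (corr w.1, corrEstimate (output w.1 w.2))
  have hg : Measurable g := measurable_corrPair
  set μ := (P.prod G).map g
  have hμ : IsProbabilityMeasure μ := Measure.isProbabilityMeasure_map hg.aemeasurable
  have hfst : μ.fst = ProbabilityTheory.cond volume (corrRegion T (gam snr)) := by
    rw [← hmap, Measure.fst, Measure.map_map measurable_fst hg]
    change (P.prod G).map (corr ∘ Prod.fst) = _
    rw [← Measure.map_map measurable_corr measurable_fst]
    change (P.prod G).fst.map corr = _
    rw [Measure.fst_prod]
  let f : (Pair T → ℝ) × (Pair T → ℝ) → ℝ := fun w => channelScore nr snr w.1 w.2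
  have hf : Measurable f := measurable_channelScore nr snr
  have hfpos : ∀ w, 0 < f w := fun w => channelScore_pos hT hnr hsnr _ _
  have hfint : Integrable f (μ.fst.prod μ.snd) :=
    integrable_of_nonneg_of_le hf _ (fun w => (hfpos w).le) fun w => score_le hv _ _ _
  have hf1 : ∫ w, f w ∂(μ.fst.prod μ.snd) ≤ 1 := by
    rw [integral_prod_symm _ hfint]
    have h1 : ∀ c, ∫ q, f (q, c) ∂μ.fst ≤ 1 := fun c => by
      rw [hfst]
      exact integral_score_cond_le_one (volume_corrRegion_pos hT (gam_pos hsnr))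
        (volume_corrRegion_lt_top _ _) hs c
    calc _ ≤ ∫ _c, (1 : ℝ) ∂μ.snd :=
          integral_mono hfint.integral_prod_right (integrable_const _) h1
      _ = 1 := by simp
  have hlog : Integrable (fun w => Real.log (f w)) μ := by
    rw [integrable_map_measure hf.log.aestronglyMeasurable hg.aemeasurable]
    exact Integrable.of_bound (hf.log.comp hg).aestronglyMeasurable K
      (Filter.Eventually.of_forall fun w => hK _ _)
  have hkl := ofReal_integral_log_le_klDiv hf hfpos hlog hfint hf1
  have hrate : T * rateBound nr T snr * Real.log 2 ≤ ∫ w, Real.log (f w) ∂μ := by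
    rw [integral_map hg.aemeasurable hf.log.aestronglyMeasurable]
    exact mul_rateBound_le_integral_log_channelScore hT hnr hsnr P
  have hle : ENNReal.ofReal (rateBound nr T snr) ≤ mutualInfo μ / T := by
    unfold mutualInfo
    rw [ENNReal.le_div_iff_mul_le (Or.inl (by exact_mod_cast hT.ne'))
        (Or.inl (ENNReal.natCast_ne_top _)),
      ENNReal.le_div_iff_mul_le (Or.inl (by simpa using hl2)) (Or.inl ENNReal.ofReal_ne_top),
      ← ENNReal.ofReal_natCast, ← ENNReal.ofReal_mul' hT0.le, ← ENNReal.ofReal_mul' hl2.le,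
      mul_comm (rateBound nr T snr)]
    exact (ENNReal.ofReal_le_ofReal hrate).trans hkl
  refine le_trans ?_ (EReal.coe_ennreal_le_coe_ennreal_iff.2 hle)
  rw [EReal.coe_ennreal_ofReal]
  exact EReal.coe_le_coe_iff.2 (le_max_left _ _)

lemma isProbabilityMeasure_jointLaw (P : Measure (Mat nt T)) [IsProbabilityMeasure P] :
    IsProbabilityMeasure (jointLaw nr P) :=
  Measure.isProbabilityMeasure_map measurable_inputOutput.aemeasurable

lemma mutualInfo_corr_le (P : Measure (Mat nt T)) [IsProbabilityMeasure P] :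
    mutualInfo ((jointLaw nr P).map (Prod.map corr corrEstimate)) ≤ mutualInfo (jointLaw nr P) :=
  have := isProbabilityMeasure_jointLaw (nr := nr) P
  mutualInfo_map_le _ measurable_corr measurable_corrEstimate

lemma rateBound_le_infoCapacity (hT : 0 < T) (hnt : T ≤ nt) (hnr : 1 ≤ nr) (hsnr : 0 < snr) :
    ((rateBound nr T snr : ℝ) : EReal) ≤ ((infoCapacity nt nr T snr : ℝ≥0∞) : EReal) := by
  obtain ⟨P, hP, htri, hmap⟩ := exists_triangular_law hT hnt hsnr
  refine (rateBound_le_mutualInfo hT hnr hsnr P hmap).trans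
    (EReal.coe_ennreal_le_coe_ennreal_iff.2 (ENNReal.div_le_div_right ?_ _))
  refine (mutualInfo_corr_le P).trans ?_
  exact le_iSup_of_le P (le_iSup₂_of_le hP (htri.mono fun X hX t => (hX.1 t).le) le_rfl)

end Channel

end OneBitMIMO

theorem mainTheorem3 (nt nr T : ℕ) (snr : ℝ) (hT : 2 ≤ T) (hnt : T ≤ nt) (hnr : 1 ≤ nr)
    (hsnr : 0 < snr) :
    ((rateBound nr T snr : ℝ) : EReal) ≤ ((capacity nt nr T snr : ENNReal) : EReal) ∧
    ((rateBound nr T snr : ℝ) : EReal) ≤ ((infoCapacity nt nr T snr : ENNReal) : EReal) ∧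
    (∃ P : MeasureTheory.Measure (Mat nt T),
      MeasureTheory.IsProbabilityMeasure P ∧ (∀ᵐ X ∂P, X ∈ triInputSet nt T snr) ∧
        P.map corr = ProbabilityTheory.cond MeasureTheory.volume (corrRegion T (gam snr))) ∧
    (∀ P : MeasureTheory.Measure (Mat nt T),
      MeasureTheory.IsProbabilityMeasure P → (∀ᵐ X ∂P, X ∈ inputSet nt T snr) →
        P.map corr = ProbabilityTheory.cond MeasureTheory.volume (corrRegion T (gam snr)) →
        ((rateBound nr T snr : ℝ) : EReal) ≤
            ((mutualInfo ((jointLaw nr P).map (Prod.map corr corrEstimate)) / T : ENNReal) :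
              EReal) ∧
          mutualInfo ((jointLaw nr P).map (Prod.map corr corrEstimate)) ≤
            mutualInfo (jointLaw nr P)) := by
  have hT0 : 0 < T := by omega
  exact ⟨rateBound_le_capacity hT0 hnt hnr hsnr, rateBound_le_infoCapacity hT0 hnt hnr hsnr,
    exists_triangular_law hT0 hnt hsnr,
    fun P _ _ hmap => ⟨rateBound_le_mutualInfo hT0 hnr hsnr P hmap, mutualInfo_corr_le P⟩⟩
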